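/- Let $d\ge 1$, let $P=[P_{ij}]$ be the transition matrix of an irreducible (possibly periodic) Markov chain on $\mathcal S_d=\{1,\dots,d\}$, and let $\pi$ be its equilibrium distribution. For $i,j\in\mathcal S_d$ let $F_{ij}$ be a distribution function on $\mathbb R$, and suppose that there is $M_0>0$ with $F_{ij}(1/M_0)=0$ and $F_{ij}(M_0)=1$ for all $i,j$. Let $Y_{ij}$ be a random variable with distribution $F_{ij}$ and put $$L_i=\sum_{j=1}^d P_{ij}\,\mathbf E(\log Y_{ij}),\qquad M_{ij}(s)=P_{ij}\,\mathbf E(Y_{ij}^s)\quad(s>0).$$ Let $(I_r,X_r)_{r\ge 0}$ be a Markov chain on $\mathcal S_d\times(0,\infty)$, with an arbitrary initial law, which jumps from $(i,x)$ to $(j,\alpha x)$ with transition measure $P_{ij}\,dF_{ij}(\alpha)$. Let $T=\sum_{r=1}^\infty X_r\in[0,\infty]$ be its total time, and for $A>0$ let $\sigma_A=\min\{r>0: X_r\le A\}$ (with $\min\emptyset=\infty$). For each $s>0$ the matrix $M(s)=[M_{ij}(s)]$ has exactly one positive eigenvalue $\eta(s)$ such that $\eta(s)\ge|\lambda|$ for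 every complex eigenvalue $\lambda$ of $M(s)$ (the Perron–Frobenius eigenvalue), and the following hold. (i) If $\sum_{i}\pi_iL_i<0$, then $X_r\to0$ a.s. as $r\to\infty$, $T<\infty$ a.s., and for every $s>0$: if $\eta(s)<1$ and $\mathbf E(X_0^s)<\infty$ (for instance if $X_0$ is a constant), then $\mathbf E(T^s)<\infty$; if $\eta(s)\ge1$, then $\mathbf E(T^s)=\infty$. (ii) If $\sum_i\pi_iL_i=0$, and there are no constants $c_1,\dots,c_d>0$ such that $Y_{ij}=c_j/c_i$ a.s. for all $i,j$ with $P_{ij}>0$, then $\sigma_A<\infty$ a.s. for every $A>0$. (iii) If $\sum_i\pi_iL_i>0$, then $X_r\to\infty$ a.s. as $r\to\infty$. -/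

import Mathlib

open MeasureTheory ProbabilityTheory Filter Topology

noncomputable section

namespace MultiplicativeModel

variable {d : ℕ} {Ω : Type*} [mΩ : MeasurableSpace Ω]

/-- The distributions `F i j` (laws of the multipliers `Y i j`) are concentrated on one interval
`(1 / M₀, M₀]` with `M₀ > 0`; in terms of distribution functions,
`F_ij(1 / M₀) = 0` and `F_ij(M₀) = 1`. -/
def BoundedMultipliers (F : Fin d → Fin d → Measure ℝ) : Prop :=
  ∃ M₀ : ℝ, 0 < M₀ ∧ ∀ i j, F i j (Set.Iic (1 / M₀)) = 0 ∧ F i j (Set.Iic M₀) = 1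

/-- The law of the next state when the present state is `(i, x)`: the next state is `(j, α x)`,
where `j` is chosen with probability `P i j` and then `α` has law `F i j`. -/
def jumpLaw (P : Matrix (Fin d) (Fin d) ℝ) (F : Fin d → Fin d → Measure ℝ)
    (z : Fin d × ℝ) : Measure (Fin d × ℝ) :=
  ∑ j, ENNReal.ofReal (P z.1 j) • (F z.1 j).map (fun α => (j, α * z.2))

/-- `(I, X)` is a multiplicative Markov chain with data `P`, `F`, with respect to the filtration
`ℱ`: it is adapted, starts with `X 0 > 0` (the law of the initial state is otherwise arbitrary),
and, given `ℱ r`, the state at time `r + 1` has conditional law `jumpLaw P F (I r, X r)`. -/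
structure IsMultiplicativeChain (P : Matrix (Fin d) (Fin d) ℝ) (F : Fin d → Fin d → Measure ℝ)
    (μ : Measure Ω) (ℱ : Filtration ℕ mΩ) (I : ℕ → Ω → Fin d) (X : ℕ → Ω → ℝ) : Prop where
  adapted_fst : ∀ r, Measurable[ℱ r] (I r)
  adapted_snd : ∀ r, Measurable[ℱ r] (X r)
  init_pos : ∀ᵐ ω ∂μ, 0 < X 0 ω
  markov : ∀ (r : ℕ) (B : Set (Fin d × ℝ)), MeasurableSet B →
    μ[Set.indicator {ω | (I (r + 1) ω, X (r + 1) ω) ∈ B} (fun _ => (1 : ℝ)) | ℱ r]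
      =ᵐ[μ] fun ω => (jumpLaw P F (I r ω, X r ω)).real B

/-- `v` is an equilibrium (stationary) distribution of the transition matrix `P`. -/
def IsEquilibrium (P : Matrix (Fin d) (Fin d) ℝ) (v : Fin d → ℝ) : Prop :=
  v ∈ stdSimplex ℝ (Fin d) ∧ Matrix.vecMul v P = v

/-- `L_i = ∑_j P_ij E(log Y_ij)`. -/
def meanLog (P : Matrix (Fin d) (Fin d) ℝ) (F : Fin d → Fin d → Measure ℝ) (i : Fin d) : ℝ :=
  ∑ j, P i j * ∫ y, Real.log y ∂(F i j)

/-- `M(s)_ij = P_ij E(Y_ij ^ s)`. -/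
def momentMatrix (P : Matrix (Fin d) (Fin d) ℝ) (F : Fin d → Fin d → Measure ℝ) (s : ℝ) :
    Matrix (Fin d) (Fin d) ℝ :=
  Matrix.of fun i j => P i j * ∫ y, y ^ s ∂(F i j)

/-- `η` is the Perron–Frobenius eigenvalue of the real matrix `A`: a positive eigenvalue that is at
least as large as the modulus of every complex eigenvalue of `A`. -/
def IsPerronFrobeniusEigenvalue (A : Matrix (Fin d) (Fin d) ℝ) (η : ℝ) : Prop :=
  0 < η ∧ Module.End.HasEigenvalue (Matrix.toLin' A) η ∧
    ∀ z : ℂ, Module.End.HasEigenvalue (Matrix.toLin' (A.map (fun x : ℝ => (x : ℂ)))) z → ‖z‖ ≤ η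

/-- The total time `T = X_1 + X_2 + ⋯`, with values in `[0, ∞]`. -/
def totalTime (X : ℕ → Ω → ℝ) (ω : Ω) : ENNReal :=
  ∑' r : ℕ, ENNReal.ofReal (X (r + 1) ω)

/-- `σ_A = min {r > 0 : X_r ≤ A}`, equal to `∞` if there is no such `r`. -/
def hitTime (X : ℕ → Ω → ℝ) (A : ℝ) (ω : Ω) : ℕ∞ :=
  ⨅ (r : ℕ) (_ : 0 < r ∧ X r ω ≤ A), (r : ℕ∞)

/-- The multipliers are deterministic and of the form `c j / c i`. In this case `X r / c (I r)` never
changes, so that `X` is just a function of the chain `I` times a constant. -/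
def IsDegenerate (P : Matrix (Fin d) (Fin d) ℝ) (F : Fin d → Fin d → Measure ℝ) : Prop :=
  ∃ c : Fin d → ℝ, (∀ i, 0 < c i) ∧ ∀ i j, 0 < P i j → ∀ᵐ y ∂(F i j), y = c j / c i

end MultiplicativeModel

end

/-! ### Perron–Frobenius theory and the Poisson equation -/

namespace MultiplicativeModel

variable {d : ℕ}

/-! Two functions of the state drive everything. If `M(s) w = η w` with `w > 0`, then `w(I_r) X_r^s`
is multiplied by exactly `η` in conditional mean at each step (`setLIntegral_weight_succ`). If `g`
solves the Poisson equation for `L`, then `log X_r + g(I_r)` has the same conditional drift `m = ∑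
π_i L_i` from every state. Neither uses aperiodicity.

Nonzero drift: a second-order expansion of the exponential shows that, for small `δ` of sign
opposite to `m`, the weight `w_i = exp(δ g_i)` satisfies `M(δ) w ≤ ρ w` with `ρ < 1`
(`exists_contraction`). Then `∑ X_r^δ < ∞` a.s., so `X_r` tends to `0` or to `∞` according to the
sign of `δ`; for `0 < δ ≤ 1`, subadditivity of `x ↦ x^δ` also gives `T < ∞`.

Moments of `T` under negative drift: if `η(s) < 1`, then `E X_r^s` decays geometrically, and
subadditivity (`s ≤ 1`) or Minkowski (`s ≥ 1`) sums the terms. If `η(s) ≥ 1`, then `E w(I_r) X_r^s`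
never decreases, whereas `X_r → 0` and `X_r ≤ T` would send it to `0` by dominated convergence if `E
T^s` were finite. This argument includes `η(s) = 1`.

Zero drift: `log X_r + g(I_r)` has martingale increments, bounded almost surely, so almost surely it
converges or is unbounded in both directions. Nondegeneracy provides jumps of size at least `ε` from
some state; by recurrence and Lévy's Borel–Cantelli lemma they occur infinitely often, which
excludes convergence. Hence `X` gets below every level. -/

theorem mulVec_eq_sum (A : Matrix (Fin d) (Fin d) ℝ) (x : Fin d → ℝ) (i : Fin d) :
    A.mulVec x i = ∑ j, A i j * x j := rfl

/-- A property of states which is inherited along positive entries of an irreducible matrix and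
holds somewhere holds everywhere. -/
theorem forall_of_isIrreducible {A : Matrix (Fin d) (Fin d) ℝ} (hA : A.IsIrreducible)
    {p : Fin d → Prop} (hp : ∀ i j, 0 < A i j → p i → p j) {i : Fin d} (hi : p i) (j : Fin d) :
    p j := by
  let := A.toQuiver
  obtain ⟨q, -⟩ := hA.connected i j
  induction q with
  | nil => exact hi
  | cons q e ih => exact hp _ _ e.down ih

theorem isIrreducible_of_pos_iff {A B : Matrix (Fin d) (Fin d) ℝ} (hA : A.IsIrreducible)
    (h0 : ∀ i j, 0 ≤ B i j) (h : ∀ i j, 0 < A i j ↔ 0 < B i j) : B.IsIrreducible := by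
  have : A.toQuiver = B.toQuiver := by
    unfold Matrix.toQuiver
    congr 1
    funext i j
    rw [propext (h i j)]
  exact ⟨h0, this ▸ hA.connected⟩

/-- Some sum of powers of an irreducible matrix is entrywise positive. -/
theorem exists_sum_pow_pos {A : Matrix (Fin d) (Fin d) ℝ} (hA : A.IsIrreducible) :
    ∃ N : ℕ, ∀ i j, 0 < (∑ k ∈ Finset.range N, A ^ k) i j := by
  have h := (Matrix.isIrreducible_iff_exists_pow_pos hA.nonneg).1 hA
  choose k _ hk using h
  refine ⟨∑ i, ∑ j, k i j + 1, fun i j => ?_⟩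
  rw [Matrix.sum_apply]
  refine Finset.sum_pos' (fun n _ => Matrix.pow_apply_nonneg hA.nonneg n i j)
    ⟨k i j, Finset.mem_range.2 (Nat.lt_succ_of_le ?_), hk i j⟩
  exact (Finset.single_le_sum (f := fun j => k i j) (fun _ _ => Nat.zero_le _)
    (Finset.mem_univ j)).trans
    (Finset.single_le_sum (f := fun i => ∑ j, k i j) (fun _ _ => Nat.zero_le _)
      (Finset.mem_univ i))

theorem mulVec_pos {B : Matrix (Fin d) (Fin d) ℝ} (hB : ∀ i j, 0 < B i j) {y : Fin d → ℝ}
    (hy : ∀ i, 0 ≤ y i) {k : Fin d} (hk : y k ≠ 0) (i : Fin d) : 0 < B.mulVec y i :=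
  Finset.sum_pos' (fun j _ => mul_nonneg (hB i j).le (hy j))
    ⟨k, Finset.mem_univ k, mul_pos (hB i k) ((hy k).lt_of_ne' hk)⟩

/-- A vector of the simplex which maximises `t` subject to `t • x ≤ A x`. -/
theorem exists_collatzWielandt_max {A : Matrix (Fin d) (Fin d) ℝ} (hd : Nonempty (Fin d))
    (hA : ∀ i j, 0 ≤ A i j) :
    ∃ t : ℝ, ∃ x ∈ stdSimplex ℝ (Fin d), 0 ≤ t ∧ (∀ i, t * x i ≤ A.mulVec x i) ∧
      ∀ t' : ℝ, ∀ x' ∈ stdSimplex ℝ (Fin d), (∀ i, t' * x' i ≤ A.mulVec x' i) → t' ≤ t := by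
  -- Summing `t x_i ≤ (A x)_i` over `i` bounds `t` by the sum of the entries, so the maximisation
  -- takes place on a compact set.
  set C : ℝ := ∑ i, ∑ j, A i j with hC
  have hbound : ∀ t' : ℝ, ∀ x' ∈ stdSimplex ℝ (Fin d),
      (∀ i, t' * x' i ≤ A.mulVec x' i) → t' ≤ C := by
    intro t x hx h
    calc t = ∑ i, t * x i := by rw [← Finset.mul_sum, hx.2, mul_one]
      _ ≤ ∑ i, A.mulVec x i := Finset.sum_le_sum fun i _ => h i
      _ ≤ C := by
          simp only [mulVec_eq_sum]
          exact Finset.sum_le_sum fun i _ => Finset.sum_le_sum fun j _ =>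
            mul_le_of_le_one_right (hA i j)
              (hx.2 ▸ Finset.single_le_sum (fun k _ => hx.1 k) (Finset.mem_univ j))
  have hC0 : 0 ≤ C := Finset.sum_nonneg fun i _ => Finset.sum_nonneg fun j _ => hA i j
  set S : Set (ℝ × (Fin d → ℝ)) :=
    (Set.Icc 0 C ×ˢ stdSimplex ℝ (Fin d)) ∩ {p | ∀ i, p.1 * p.2 i ≤ A.mulVec p.2 i} with hS
  have hScompact : IsCompact S := by
    refine (isCompact_Icc.prod (isCompact_stdSimplex ℝ (Fin d))).inter_right ?_
    simp only [Set.ofPred_forall]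
    refine isClosed_iInter fun i => isClosed_le (by fun_prop) ?_
    simp only [mulVec_eq_sum]
    fun_prop
  obtain ⟨k⟩ := hd
  have hne : S.Nonempty := by
    refine ⟨(0, Pi.single k 1), ⟨⟨⟨le_rfl, hC0⟩, single_mem_stdSimplex ℝ k⟩, fun i => ?_⟩⟩
    rw [zero_mul, mulVec_eq_sum]
    exact Finset.sum_nonneg fun j _ => mul_nonneg (hA i j)
      ((single_mem_stdSimplex ℝ k).1 j)
  obtain ⟨⟨t, x⟩, hmem, hmax⟩ := hScompact.exists_isMaxOn hne continuous_fst.continuousOn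
  refine ⟨t, x, hmem.1.2, hmem.1.1.1, hmem.2, fun t' x' hx' h' => ?_⟩
  rcases le_total t' 0 with h0 | h0
  · exact h0.trans hmem.1.1.1
  · exact hmax (show (t', x') ∈ S from ⟨⟨⟨h0, hbound t' x' hx' h'⟩, hx'⟩, h'⟩)

/-- An irreducible matrix has a positive eigenvector with a positive eigenvalue. -/
theorem exists_pos_eigenvector {A : Matrix (Fin d) (Fin d) ℝ} (hd : Nonempty (Fin d))
    (hA : A.IsIrreducible) :
    ∃ η : ℝ, 0 < η ∧ ∃ x : Fin d → ℝ, (∀ i, 0 < x i) ∧ A.mulVec x = η • x := by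
  obtain ⟨t, x, hx, ht0, htx, hmax⟩ := exists_collatzWielandt_max hd hA.nonneg
  obtain ⟨N, hN⟩ := exists_sum_pow_pos hA
  set B := ∑ k ∈ Finset.range N, A ^ k with hB
  have hcomm : A * B = B * A := by
    rw [hB, Finset.mul_sum, Finset.sum_mul]
    exact Finset.sum_congr rfl fun k _ => by rw [← pow_succ', ← pow_succ]
  obtain ⟨k, hk⟩ : ∃ k, x k ≠ 0 := by
    by_contra! h
    have := hx.2
    simp [h] at this
  have hBx : ∀ i, 0 < B.mulVec x i := mulVec_pos hN hx.1 hk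
  -- If `y = A x - t x ≥ 0` were nonzero, the positive matrix `B`, which commutes with `A`, would
  -- give `A z - t z = B y > 0` for `z = B x`. Then `t` could be raised by the least ratio `δ`,
  -- against maximality.
  have heig : A.mulVec x = t • x := by
    by_contra hne
    set y : Fin d → ℝ := A.mulVec x - t • x with hy
    have hy0 : ∀ i, 0 ≤ y i := fun i => by simpa [hy] using htx i
    obtain ⟨l, hl⟩ : ∃ l, y l ≠ 0 := by
      by_contra! h
      exact hne (sub_eq_zero.1 (funext h))
    set z := B.mulVec x with hz
    have hBy : B.mulVec y = A.mulVec z - t • z := by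
      rw [hy, hz, Matrix.mulVec_sub, Matrix.mulVec_smul, Matrix.mulVec_mulVec,
        Matrix.mulVec_mulVec, hcomm]
    have hpos : ∀ i, 0 < A.mulVec z i - t * z i := fun i => by
      simpa [hBy] using mulVec_pos hN hy0 hl i
    have := hd
    obtain ⟨m, hm⟩ := Finite.exists_min fun i => (A.mulVec z i - t * z i) / z i
    set δ := (A.mulVec z m - t * z m) / z m with hδ
    have hδ0 : 0 < δ := div_pos (hpos m) (hBx m)
    have hz1 : 0 < ∑ i, z i := Finset.sum_pos (fun i _ => hBx i) Finset.univ_nonempty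
    have := hmax (t + δ) ((∑ i, z i)⁻¹ • z) ⟨fun i => ?_, ?_⟩ fun i => ?_
    · linarith
    · exact mul_nonneg (inv_nonneg.2 hz1.le) (hBx i).le
    · simp only [Pi.smul_apply, smul_eq_mul]
      rw [← Finset.mul_sum, inv_mul_cancel₀ hz1.ne']
    · have h1 := (le_div_iff₀ (hBx i)).1 (hm i)
      rw [Matrix.mulVec_smul]
      simp only [Pi.smul_apply, smul_eq_mul]
      calc (t + δ) * ((∑ i, z i)⁻¹ * z i) = (∑ i, z i)⁻¹ * (t * z i + δ * z i) := by ring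
        _ ≤ (∑ i, z i)⁻¹ * A.mulVec z i :=
            mul_le_mul_of_nonneg_left (by linarith) (inv_nonneg.2 hz1.le)
  -- A zero coordinate of `x` forces `∑ j, A i j * x j = 0`, so zeros spread along positive entries
  -- to all coordinates.
  have hxpos : ∀ i, 0 < x i := by
    intro i
    refine (hx.1 i).lt_of_ne' fun hi => hk ?_
    refine forall_of_isIrreducible hA (p := fun i => x i = 0) (fun i j hij h => ?_) hi k
    have h2 : ∑ j, A i j * x j = 0 := by rw [← mulVec_eq_sum, heig]; simp [h]
    have h3 := (Finset.sum_eq_zero_iff_of_nonneg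
      fun j _ => mul_nonneg (hA.nonneg i j) (hx.1 j)).1 h2 j (Finset.mem_univ j)
    exact (mul_eq_zero.1 h3).resolve_left hij.ne'
  refine ⟨t, ht0.lt_of_ne' fun h0 => ?_, x, hxpos, heig⟩
  obtain ⟨n, hn, hnk⟩ := (Matrix.isIrreducible_iff_exists_pow_pos hA.nonneg).1 hA k k
  obtain ⟨m, rfl⟩ : ∃ m, n = m + 1 := ⟨n - 1, by lia⟩
  have hA0 : A = 0 := by
    ext i j
    have h2 : ∑ j, A i j * x j = 0 := by rw [← mulVec_eq_sum, heig, h0]; simp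
    have h3 := (Finset.sum_eq_zero_iff_of_nonneg
      fun j _ => mul_nonneg (hA.nonneg i j) (hx.1 j)).1 h2 j (Finset.mem_univ j)
    exact (mul_eq_zero.1 h3).resolve_right (hxpos j).ne'
  simp [hA0] at hnk

/-- The eigenvalue of a positive eigenvector of a nonnegative matrix dominates all complex
eigenvalues. -/
theorem norm_le_of_pos_eigenvector {A : Matrix (Fin d) (Fin d) ℝ} (hA : ∀ i j, 0 ≤ A i j)
    {η : ℝ} {x : Fin d → ℝ} (hx : ∀ i, 0 < x i) (hAx : A.mulVec x = η • x) {z : ℂ}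
    (hz : Module.End.HasEigenvalue (Matrix.toLin' (A.map (fun x : ℝ => (x : ℂ)))) z) :
    ‖z‖ ≤ η := by
  obtain ⟨u, hu⟩ := hz.exists_hasEigenvector
  have hu1 : (A.map (fun x : ℝ => (x : ℂ))).mulVec u = z • u := by
    simpa using hu.apply_eq_smul
  obtain ⟨k, hk⟩ := Function.ne_iff.1 hu.2
  have : Nonempty (Fin d) := ⟨k⟩
  -- The eigenvalue equation is read at the coordinate where `|u|` is largest relative to `x`.
  obtain ⟨m, hm⟩ := Finite.exists_max fun i => ‖u i‖ / x i
  set c := ‖u m‖ / x m with hc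
  have hle : ∀ j, ‖u j‖ ≤ c * x j := fun j => (div_le_iff₀ (hx j)).1 (hm j)
  have hc0 : 0 < c := lt_of_lt_of_le (div_pos (norm_pos_iff.2 hk) (hx k)) (hm k)
  have hum : ‖u m‖ = c * x m := by rw [hc, div_mul_cancel₀ _ (hx m).ne']
  have h1 : ‖z‖ * ‖u m‖ ≤ η * ‖u m‖ := by
    calc ‖z‖ * ‖u m‖ = ‖(z • u) m‖ := by simp
      _ = ‖∑ j, (A m j : ℂ) * u j‖ := by rw [← hu1]; rfl
      _ ≤ ∑ j, ‖(A m j : ℂ) * u j‖ := norm_sum_le _ _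
      _ ≤ ∑ j, A m j * (c * x j) := Finset.sum_le_sum fun j _ => by
          rw [norm_mul, Complex.norm_real, Real.norm_of_nonneg (hA m j)]
          exact mul_le_mul_of_nonneg_left (hle j) (hA m j)
      _ = c * A.mulVec x m := by
          rw [Matrix.mulVec, dotProduct, Finset.mul_sum]
          exact Finset.sum_congr rfl fun j _ => by ring
      _ = η * ‖u m‖ := by rw [hAx, hum]; simp; ring
  exact le_of_mul_le_mul_right h1 (hum ▸ mul_pos hc0 (hx m))

theorem isPerronFrobeniusEigenvalue_of_pos_eigenvector {A : Matrix (Fin d) (Fin d) ℝ}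
    (hd : Nonempty (Fin d)) (hA : ∀ i j, 0 ≤ A i j) {η : ℝ} (hη : 0 < η) {x : Fin d → ℝ}
    (hx : ∀ i, 0 < x i) (hAx : A.mulVec x = η • x) : IsPerronFrobeniusEigenvalue A η := by
  refine ⟨hη, Module.End.hasEigenvalue_of_hasEigenvector (x := x) ?_,
    fun z hz => norm_le_of_pos_eigenvector hA hx hAx hz⟩
  rw [Module.End.hasEigenvector_iff, Module.End.mem_eigenspace_iff, Matrix.toLin'_apply]
  exact ⟨hAx, fun h => (hx hd.some).ne' (congrFun h _)⟩

/-- A real eigenvalue is also a complex one, so each of the two candidates is dominated by the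
other. -/
theorem IsPerronFrobeniusEigenvalue.unique {A : Matrix (Fin d) (Fin d) ℝ} {η η' : ℝ}
    (h : IsPerronFrobeniusEigenvalue A η) (h' : IsPerronFrobeniusEigenvalue A η') : η = η' := by
  have key : ∀ {a b : ℝ}, IsPerronFrobeniusEigenvalue A a → IsPerronFrobeniusEigenvalue A b →
      a ≤ b := by
    intro a b ha hb
    obtain ⟨u, hu⟩ := ha.2.1.exists_hasEigenvector
    have hu1 : A.mulVec u = a • u := by simpa using hu.apply_eq_smul
    have : Module.End.HasEigenvalue (Matrix.toLin' (A.map (fun x : ℝ => (x : ℂ)))) (a : ℂ) := by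
      refine Module.End.hasEigenvalue_of_hasEigenvector (x := fun i => (u i : ℂ)) ?_
      rw [Module.End.hasEigenvector_iff, Module.End.mem_eigenspace_iff, Matrix.toLin'_apply]
      constructor
      · ext i
        have := congrArg (fun x : ℝ => (x : ℂ)) (congrFun hu1 i)
        simpa [Matrix.mulVec, dotProduct] using this
      · intro h0
        refine hu.2 (funext fun i => ?_)
        simpa using congrFun h0 i
    have h2 := hb.2.2 _ this
    rwa [Complex.norm_real, Real.norm_of_nonneg ha.1.le] at h2
  exact le_antisymm (key h h') (key h' h)

/-- Harmonic functions of an irreducible chain are constant. -/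
theorem eq_of_mulVec_eq_self {P : Matrix (Fin d) (Fin d) ℝ}
    (hP : P ∈ Matrix.rowStochastic ℝ (Fin d)) (hirr : P.IsIrreducible) {f : Fin d → ℝ}
    (hf : P.mulVec f = f) (i j : Fin d) : f i = f j := by
  have : Nonempty (Fin d) := ⟨i⟩
  obtain ⟨m, hm⟩ := Finite.exists_max f
  have h : ∀ k, f k = f m := by
    refine forall_of_isIrreducible hirr (fun a b hab ha => ?_) (rfl : f m = f m)
    -- Maximum principle: the average of the nonnegative gaps `f m - f k` is zero at a maximiser, so
    -- each reachable gap is zero.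
    have h1 : ∑ k, P a k * (f m - f k) = 0 := by
      simp only [mul_sub, Finset.sum_sub_distrib]
      rw [← Finset.sum_mul, Matrix.sum_row_of_mem_rowStochastic hP, one_mul, sub_eq_zero, ← ha]
      exact (congrFun hf a).symm
    have h2 := (Finset.sum_eq_zero_iff_of_nonneg fun k _ =>
      mul_nonneg (hirr.nonneg a k) (sub_nonneg.2 (hm k))).1 h1 b (Finset.mem_univ b)
    have := (mul_eq_zero.1 h2).resolve_left hab.ne'
    linarith
  rw [h i, h j]

/-- Solution of the Poisson equation of an irreducible finite chain. -/
theorem exists_poisson {P : Matrix (Fin d) (Fin d) ℝ}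
    (hP : P ∈ Matrix.rowStochastic ℝ (Fin d)) (hirr : P.IsIrreducible) {v : Fin d → ℝ}
    (hv : IsEquilibrium P v) (L : Fin d → ℝ) :
    ∃ g : Fin d → ℝ, ∀ i, L i + P.mulVec g i - g i = ∑ k, v k * L k := by
  set T : (Fin d → ℝ) →ₗ[ℝ] (Fin d → ℝ) := P.mulVecLin - LinearMap.id with hT
  set φ : (Fin d → ℝ) →ₗ[ℝ] ℝ := dotProductBilin ℝ ℝ v with hφ
  have hφa : ∀ u, φ u = ∑ k, v k * u k := fun u => rfl
  have hTa : ∀ u i, T u i = P.mulVec u i - u i := fun u i => rfl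
  have hφ1 : φ 1 = 1 := by simpa [hφa] using hv.1.2
  -- Stationarity puts the range of `P - 1` inside the hyperplane `v · u = 0`. Its kernel consists
  -- of constants, so the dimensions agree and the hyperplane is the whole range.
  have hle : LinearMap.range T ≤ LinearMap.ker φ := by
    rintro _ ⟨u, rfl⟩
    rw [LinearMap.mem_ker]
    have : φ (T u) = dotProduct v (P.mulVec u) - dotProduct v u := by
      rw [← dotProduct_sub]; rfl
    rw [this, Matrix.dotProduct_mulVec, hv.2, sub_self]
  have hker : LinearMap.ker T ≤ Submodule.span ℝ {(1 : Fin d → ℝ)} := by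
    intro u hu
    rw [LinearMap.mem_ker] at hu
    have hPu : P.mulVec u = u := sub_eq_zero.1 hu
    rw [Submodule.mem_span_singleton]
    rcases isEmpty_or_nonempty (Fin d) with h | ⟨⟨k⟩⟩
    · exact ⟨0, Subsingleton.elim _ _⟩
    · exact ⟨u k, funext fun i => by simpa using eq_of_mulVec_eq_self hP hirr hPu k i⟩
  have h1 : Module.finrank ℝ (LinearMap.ker T) ≤ 1 :=
    (Submodule.finrank_mono hker).trans
      ((finrank_span_le_card _).trans (by simp))
  have hrange : LinearMap.range φ = ⊤ := LinearMap.range_eq_top.2 fun c =>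
    ⟨c • 1, by rw [map_smul, hφ1, smul_eq_mul, mul_one]⟩
  have h2 := T.finrank_range_add_finrank_ker
  have h3 := φ.finrank_range_add_finrank_ker
  rw [hrange, finrank_top, Module.finrank_self] at h3
  have heq := Submodule.eq_of_le_of_finrank_le hle (by lia)
  set m := ∑ k, v k * L k with hm
  have hmem : (fun i => m - L i) ∈ LinearMap.ker φ := by
    rw [LinearMap.mem_ker, hφa]
    simp only [mul_sub, Finset.sum_sub_distrib]
    rw [← Finset.sum_mul, hv.1.2, one_mul, sub_self]
  rw [← heq] at hmem
  obtain ⟨g, hg⟩ := hmem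
  refine ⟨g, fun i => ?_⟩
  have := congrFun hg i
  rw [hTa] at this
  linarith

end MultiplicativeModel

/-! ### Moments of the multipliers, centring and exponential contraction -/

namespace MultiplicativeModel

variable {d : ℕ}

theorem BoundedMultipliers.exists_abs_log_le {F : Fin d → Fin d → Measure ℝ}
    [∀ i j, IsProbabilityMeasure (F i j)] (hF : BoundedMultipliers F) :
    ∃ K : ℝ, ∀ i j, ∀ᵐ y ∂(F i j), 0 < y ∧ |Real.log y| ≤ K := by
  obtain ⟨M, hM, h⟩ := hF
  refine ⟨Real.log M, fun i j => ?_⟩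
  have h1 : ∀ᵐ y ∂(F i j), y ∉ Set.Iic (1 / M) := measure_eq_zero_iff_ae_notMem.1 (h i j).1
  have h2 : ∀ᵐ y ∂(F i j), y ∈ Set.Iic M :=
    (mem_ae_iff_prob_eq_one measurableSet_Iic).2 (h i j).2
  filter_upwards [h1, h2] with y hy1 hy2
  rw [Set.mem_Iic, not_le] at hy1
  have hy0 : 0 < y := (one_div_pos.2 hM).trans hy1
  refine ⟨hy0, abs_le.2 ⟨?_, Real.log_le_log hy0 hy2⟩⟩
  rw [← Real.log_inv, ← one_div]
  exact Real.log_le_log (one_div_pos.2 hM) hy1.le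

theorem integrable_of_ae_abs_le {ν : Measure ℝ} [IsFiniteMeasure ν] {f : ℝ → ℝ}
    (hf : Measurable f) {C : ℝ} (h : ∀ᵐ y ∂ν, |f y| ≤ C) : Integrable f ν :=
  Integrable.of_bound hf.aestronglyMeasurable C (by simpa using h)

theorem rpow_le_exp_of_abs_log_le {y K s : ℝ} (h : 0 < y ∧ |Real.log y| ≤ K) :
    y ^ s ≤ Real.exp (K * |s|) := by
  rw [Real.rpow_def_of_pos h.1]
  refine Real.exp_le_exp.2 ((le_abs_self _).trans ?_)
  rw [abs_mul]
  exact mul_le_mul_of_nonneg_right h.2 (abs_nonneg s)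

theorem integrable_rpow {F : Fin d → Fin d → Measure ℝ} [∀ i j, IsProbabilityMeasure (F i j)]
    (hF : BoundedMultipliers F) (s : ℝ) (i j : Fin d) : Integrable (fun y => y ^ s) (F i j) := by
  obtain ⟨K, hK⟩ := hF.exists_abs_log_le
  refine integrable_of_ae_abs_le (by fun_prop) (C := Real.exp (K * |s|)) ?_
  filter_upwards [hK i j] with y hy
  rw [abs_of_nonneg (Real.rpow_nonneg hy.1.le s)]
  exact rpow_le_exp_of_abs_log_le hy

theorem integrable_log {F : Fin d → Fin d → Measure ℝ} [∀ i j, IsProbabilityMeasure (F i j)]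
    (hF : BoundedMultipliers F) (i j : Fin d) : Integrable Real.log (F i j) := by
  obtain ⟨K, hK⟩ := hF.exists_abs_log_le
  exact integrable_of_ae_abs_le Real.measurable_log ((hK i j).mono fun y hy => hy.2)

theorem integral_rpow_pos {F : Fin d → Fin d → Measure ℝ} [∀ i j, IsProbabilityMeasure (F i j)]
    (hF : BoundedMultipliers F) (s : ℝ) (i j : Fin d) : 0 < ∫ y, y ^ s ∂(F i j) := by
  obtain ⟨K, hK⟩ := hF.exists_abs_log_le
  refine (integral_pos_iff_support_of_nonneg_ae ?_ (integrable_rpow hF s i j)).2 ?_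
  · filter_upwards [hK i j] with y hy using Real.rpow_nonneg hy.1.le s
  · have : (1 : ENNReal) ≤ F i j (Function.support fun y : ℝ => y ^ s) := by
      rw [← measure_univ (μ := F i j)]
      refine measure_mono_ae ?_
      filter_upwards [hK i j] with y hy _ using (Real.rpow_pos_of_pos hy.1 s).ne'
    exact zero_lt_one.trans_le this

theorem isIrreducible_momentMatrix {P : Matrix (Fin d) (Fin d) ℝ} (hirr : P.IsIrreducible)
    {F : Fin d → Fin d → Measure ℝ} [∀ i j, IsProbabilityMeasure (F i j)]
    (hF : BoundedMultipliers F) (s : ℝ) : (momentMatrix P F s).IsIrreducible :=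
  isIrreducible_of_pos_iff hirr
    (fun i j => mul_nonneg (hirr.nonneg i j) (integral_rpow_pos hF s i j).le)
    (fun i j => (mul_pos_iff_of_pos_right (integral_rpow_pos hF s i j)).symm)

/-- The Poisson correction `g` evens out the state-dependent drifts, so that one number `m` governs
every state. -/
theorem exists_centering {P : Matrix (Fin d) (Fin d) ℝ}
    (hP : P ∈ Matrix.rowStochastic ℝ (Fin d)) (hirr : P.IsIrreducible)
    {F : Fin d → Fin d → Measure ℝ} [∀ i j, IsProbabilityMeasure (F i j)]
    (hF : BoundedMultipliers F) {v : Fin d → ℝ} (hv : IsEquilibrium P v) :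
    ∃ g : Fin d → ℝ, ∀ i, ∑ j, P i j * ∫ y, (Real.log y + (g j - g i)) ∂(F i j) =
      ∑ k, v k * meanLog P F k := by
  obtain ⟨g, hg⟩ := exists_poisson hP hirr hv (meanLog P F)
  refine ⟨g, fun i => ?_⟩
  rw [← hg i, mulVec_eq_sum]
  have : ∀ j, ∫ y, (Real.log y + (g j - g i)) ∂(F i j) =
      ∫ y, Real.log y ∂(F i j) + (g j - g i) := fun j => by
    rw [integral_add (integrable_log hF i j) (integrable_const _)]
    simp
  simp only [this, mul_add, mul_sub, Finset.sum_add_distrib, Finset.sum_sub_distrib]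
  rw [← Finset.sum_mul, Matrix.sum_row_of_mem_rowStochastic hP, one_mul, meanLog]
  ring

theorem exists_abs_log_add_le {F : Fin d → Fin d → Measure ℝ}
    [∀ i j, IsProbabilityMeasure (F i j)] (hF : BoundedMultipliers F) (g : Fin d → ℝ) :
    ∃ K : ℝ, 0 ≤ K ∧ ∀ i j, ∀ᵐ y ∂(F i j), 0 < y ∧ |Real.log y + (g j - g i)| ≤ K := by
  obtain ⟨K, hK⟩ := hF.exists_abs_log_le
  have hle : ∀ i j, |g j - g i| ≤ ∑ i, ∑ j, |g j - g i| := fun i j =>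
    (Finset.single_le_sum (f := fun j => |g j - g i|) (fun _ _ => abs_nonneg _)
      (Finset.mem_univ j)).trans
    (Finset.single_le_sum (f := fun i => ∑ j, |g j - g i|)
      (fun _ _ => Finset.sum_nonneg fun _ _ => abs_nonneg _) (Finset.mem_univ i))
  refine ⟨|K| + ∑ i, ∑ j, |g j - g i|, add_nonneg (abs_nonneg _) (Finset.sum_nonneg fun _ _ =>
    Finset.sum_nonneg fun _ _ => abs_nonneg _), fun i j => ?_⟩
  filter_upwards [hK i j] with y hy
  exact ⟨hy.1, (abs_add_le _ _).trans (add_le_add (hy.2.trans (le_abs_self K)) (hle i j))⟩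

/-- When the drift `m` does not vanish, some moment matrix `M(δ)` with `δ` small and of sign
opposite to `m` is a strict contraction in a weighted norm. -/
theorem exists_contraction {P : Matrix (Fin d) (Fin d) ℝ}
    (hP : P ∈ Matrix.rowStochastic ℝ (Fin d)) (hirr : P.IsIrreducible)
    {F : Fin d → Fin d → Measure ℝ} [∀ i j, IsProbabilityMeasure (F i j)]
    (hF : BoundedMultipliers F) {v : Fin d → ℝ} (hv : IsEquilibrium P v)
    (hm : ∑ i, v i * meanLog P F i ≠ 0) :
    ∃ δ : ℝ, δ * (∑ i, v i * meanLog P F i) < 0 ∧ |δ| ≤ 1 ∧ ∃ ρ < 1, ∃ w : Fin d → ℝ,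
      (∀ i, 0 < w i) ∧ ∀ i, (momentMatrix P F δ).mulVec w i ≤ ρ * w i := by
  obtain ⟨g, hg⟩ := exists_centering hP hirr hF hv
  obtain ⟨K, hK0, hK⟩ := exists_abs_log_add_le hF g
  set m := ∑ i, v i * meanLog P F i
  have hm0 : 0 < |m| := abs_pos.2 hm
  have hDpos : 0 < 1 + K ^ 2 + K * |m| + |m| := by positivity
  -- With `δ = -t m`, the factor `ρ = 1 + δ m + δ² K²` equals `1 - t m² (1 - t K²)`. The denominator
  -- is large enough to give `|δ| ≤ 1`, `|δ| K ≤ 1` and `t K² < 1` together.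
  set t : ℝ := 1 / (1 + K ^ 2 + K * |m| + |m|) with ht
  have ht0 : 0 < t := one_div_pos.2 hDpos
  have htD : t * (1 + K ^ 2 + K * |m| + |m|) = 1 := one_div_mul_cancel hDpos.ne'
  have hKm : 0 ≤ K * |m| := by positivity
  have hm2 : 0 < m ^ 2 := by positivity
  have h1 : t * |m| ≤ 1 := by nlinarith [sq_nonneg K]
  have h2 : t * |m| * K ≤ 1 := by nlinarith [sq_nonneg K]
  have h3 : t * K ^ 2 < 1 := by nlinarith
  have habs : |-t * m| = t * |m| := by rw [abs_mul, abs_neg, abs_of_pos ht0]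
  refine ⟨-t * m, by nlinarith, habs ▸ h1, 1 + -t * m * m + (-t * m) ^ 2 * K ^ 2, ?_,
    fun i => Real.exp (-t * m * g i), fun i => Real.exp_pos _, fun i => ?_⟩
  · nlinarith [mul_pos (mul_pos ht0 hm2) (sub_pos.2 h3)]
  set δ := -t * m
  -- This integrates `exp x ≤ 1 + x + x²`, valid for `|x| ≤ 1`, at `x = δ (log y + g j - g i)`.
  have hterm : ∀ j, (∫ y, y ^ δ ∂(F i j)) * Real.exp (δ * g j) ≤
      (1 + δ * ∫ y, (Real.log y + (g j - g i)) ∂(F i j) + δ ^ 2 * K ^ 2) *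
        Real.exp (δ * g i) := by
    intro j
    have hint : Integrable (fun y => Real.log y + (g j - g i)) (F i j) :=
      (integrable_log hF i j).add (integrable_const _)
    have hsub : Real.exp (δ * g j) = Real.exp (δ * (g j - g i)) * Real.exp (δ * g i) := by
      rw [← Real.exp_add]; ring_nf
    rw [hsub, ← mul_assoc]
    refine mul_le_mul_of_nonneg_right ?_ (Real.exp_pos _).le
    have hI : ∫ y, (1 + δ * (Real.log y + (g j - g i)) + δ ^ 2 * K ^ 2) ∂(F i j) =
        1 + δ * ∫ y, (Real.log y + (g j - g i)) ∂(F i j) + δ ^ 2 * K ^ 2 := by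
      have hint1 : Integrable (fun y => 1 + δ * (Real.log y + (g j - g i))) (F i j) :=
        (integrable_const _).add (hint.const_mul δ)
      rw [integral_add hint1 (integrable_const _),
        integral_add (integrable_const _) (hint.const_mul δ), integral_const_mul]
      simp
    rw [← hI, ← integral_mul_const]
    refine integral_mono_ae ((integrable_rpow hF δ i j).mul_const _)
      (((integrable_const _).add (hint.const_mul δ)).add (integrable_const _)) ?_
    filter_upwards [hK i j] with y hy
    have hexp : y ^ δ * Real.exp (δ * (g j - g i)) =
        Real.exp (δ * (Real.log y + (g j - g i))) := by
      rw [Real.rpow_def_of_pos hy.1, ← Real.exp_add]; ring_nf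
    have hle : |δ * (Real.log y + (g j - g i))| ≤ 1 := by
      rw [abs_mul, habs]
      exact (mul_le_mul_of_nonneg_left hy.2 (by positivity)).trans h2
    have h4 := (abs_le.1 (Real.abs_exp_sub_one_sub_id_le hle)).2
    have h5 : (Real.log y + (g j - g i)) ^ 2 ≤ K ^ 2 := sq_le_sq' (abs_le.1 hy.2).1 (abs_le.1 hy.2).2
    have h6 : (δ * (Real.log y + (g j - g i))) ^ 2 ≤ δ ^ 2 * K ^ 2 := by
      rw [mul_pow]
      exact mul_le_mul_of_nonneg_left h5 (sq_nonneg δ)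
    simp only [hexp]
    linarith
  calc (momentMatrix P F δ).mulVec (fun i => Real.exp (δ * g i)) i
      = ∑ j, P i j * ((∫ y, y ^ δ ∂(F i j)) * Real.exp (δ * g j)) := by
        rw [mulVec_eq_sum]
        exact Finset.sum_congr rfl fun j _ => by simp [momentMatrix, mul_assoc]
    _ ≤ ∑ j, P i j * ((1 + δ * ∫ y, (Real.log y + (g j - g i)) ∂(F i j) + δ ^ 2 * K ^ 2) *
        Real.exp (δ * g i)) :=
        Finset.sum_le_sum fun j _ => mul_le_mul_of_nonneg_left (hterm j) (hirr.nonneg i j)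
    _ = ((1 + δ ^ 2 * K ^ 2) * ∑ j, P i j +
          δ * ∑ j, P i j * ∫ y, (Real.log y + (g j - g i)) ∂(F i j)) * Real.exp (δ * g i) := by
        rw [Finset.mul_sum, Finset.mul_sum, ← Finset.sum_add_distrib, Finset.sum_mul]
        exact Finset.sum_congr rfl fun j _ => by ring
    _ = (1 + δ * m + δ ^ 2 * K ^ 2) * Real.exp (δ * g i) := by
        rw [hg i, Matrix.sum_row_of_mem_rowStochastic hP]; ring

end MultiplicativeModel

/-! ### The Markov property in integrated form -/

namespace MultiplicativeModel

variable {d : ℕ} {Ω : Type*} [mΩ : MeasurableSpace Ω]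

theorem measurable_jumpLaw (P : Matrix (Fin d) (Fin d) ℝ) (F : Fin d → Fin d → Measure ℝ)
    [∀ i j, IsProbabilityMeasure (F i j)] : Measurable (jumpLaw P F) := by
  refine measurable_from_prod_countable_right fun i => ?_
  refine Measure.measurable_of_measurable_coe _ fun B hB => ?_
  simp only [jumpLaw, Measure.coe_finsetSum, Finset.sum_apply, Measure.smul_apply, smul_eq_mul]
  refine Finset.measurable_sum _ fun j _ => Measurable.const_mul ?_ _
  have h : ∀ x : ℝ, (F i j).map (fun α => (j, α * x)) B =
      F i j (Prod.mk x ⁻¹' ((fun p : ℝ × ℝ => (j, p.2 * p.1)) ⁻¹' B)) := fun x => by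
    rw [Measure.map_apply (by fun_prop) hB]
    rfl
  simp only [h]
  exact measurable_measure_prodMk_left ((by fun_prop :
    Measurable fun p : ℝ × ℝ => (j, p.2 * p.1)) hB)

/-- The transition kernel of the multiplicative chain. -/
noncomputable def jumpKernel (P : Matrix (Fin d) (Fin d) ℝ) (F : Fin d → Fin d → Measure ℝ)
    [∀ i j, IsProbabilityMeasure (F i j)] : Kernel (Fin d × ℝ) (Fin d × ℝ) :=
  ⟨jumpLaw P F, measurable_jumpLaw P F⟩

theorem isProbabilityMeasure_jumpLaw {P : Matrix (Fin d) (Fin d) ℝ}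
    (hP : P ∈ Matrix.rowStochastic ℝ (Fin d)) (F : Fin d → Fin d → Measure ℝ)
    [∀ i j, IsProbabilityMeasure (F i j)] (z : Fin d × ℝ) :
    IsProbabilityMeasure (jumpLaw P F z) := by
  constructor
  simp only [jumpLaw, Measure.coe_finsetSum, Finset.sum_apply, Measure.smul_apply, smul_eq_mul]
  have h : ∀ j, (F z.1 j).map (fun α => (j, α * z.2)) Set.univ = 1 := fun j => by
    rw [Measure.map_apply (by fun_prop) MeasurableSet.univ]
    simp
  simp only [h, mul_one]
  rw [← ENNReal.ofReal_sum_of_nonneg fun j _ => Matrix.nonneg_of_mem_rowStochastic hP,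
    Matrix.sum_row_of_mem_rowStochastic hP, ENNReal.ofReal_one]

theorem lintegral_jumpLaw (P : Matrix (Fin d) (Fin d) ℝ) (F : Fin d → Fin d → Measure ℝ)
    (z : Fin d × ℝ) {f : Fin d × ℝ → ENNReal} (hf : Measurable f) :
    ∫⁻ u, f u ∂(jumpLaw P F z) =
      ∑ j, ENNReal.ofReal (P z.1 j) * ∫⁻ α, f (j, α * z.2) ∂(F z.1 j) := by
  simp only [jumpLaw, lintegral_finsetSum_measure, lintegral_smul_measure, smul_eq_mul]
  exact Finset.sum_congr rfl fun j _ => by rw [lintegral_map hf (by fun_prop)]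

theorem integral_jumpLaw {P : Matrix (Fin d) (Fin d) ℝ} (hP : ∀ i j, 0 ≤ P i j)
    (F : Fin d → Fin d → Measure ℝ) [∀ i j, IsProbabilityMeasure (F i j)]
    (z : Fin d × ℝ) {f : Fin d × ℝ → ℝ} (hf : Measurable f) {C : ℝ} (hC : ∀ u, |f u| ≤ C) :
    ∫ u, f u ∂(jumpLaw P F z) = ∑ j, P z.1 j * ∫ α, f (j, α * z.2) ∂(F z.1 j) := by
  rw [jumpLaw, integral_finsetSum_measure]
  · refine Finset.sum_congr rfl fun j _ => ?_
    rw [integral_smul_measure, ENNReal.toReal_ofReal (hP _ _), smul_eq_mul,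
      integral_map (by fun_prop) hf.aestronglyMeasurable]
  · intro j _
    have : IsProbabilityMeasure ((F z.1 j).map (fun α => (j, α * z.2))) :=
      Measure.isProbabilityMeasure_map (by fun_prop)
    exact (Integrable.of_bound hf.aestronglyMeasurable C
      (Eventually.of_forall hC)).smul_measure ENNReal.ofReal_ne_top

variable {P : Matrix (Fin d) (Fin d) ℝ} {F : Fin d → Fin d → Measure ℝ}
  [∀ i j, IsProbabilityMeasure (F i j)] {μ : Measure Ω} [IsProbabilityMeasure μ]
  {ℱ : Filtration ℕ mΩ} {I : ℕ → Ω → Fin d} {X : ℕ → Ω → ℝ}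

namespace IsMultiplicativeChain

theorem measurable_pair (h : IsMultiplicativeChain P F μ ℱ I X) (r : ℕ) :
    Measurable[ℱ r] fun ω => (I r ω, X r ω) :=
  (h.adapted_fst r).prodMk (h.adapted_snd r)

theorem measurable_pair' (h : IsMultiplicativeChain P F μ ℱ I X) (r : ℕ) :
    Measurable fun ω => (I r ω, X r ω) :=
  (h.measurable_pair r).mono (ℱ.le r) le_rfl

theorem measurable_state (h : IsMultiplicativeChain P F μ ℱ I X) (r : ℕ) : Measurable (I r) :=
  (h.adapted_fst r).mono (ℱ.le r) le_rfl

theorem measurable_value (h : IsMultiplicativeChain P F μ ℱ I X) (r : ℕ) : Measurable (X r) :=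
  (h.adapted_snd r).mono (ℱ.le r) le_rfl

/-- The `markov` field integrated over an event of the past; on rectangles this already determines
the joint law of two consecutive states. -/
theorem measure_inter_eq (h : IsMultiplicativeChain P F μ ℱ I X)
    (hP : P ∈ Matrix.rowStochastic ℝ (Fin d)) (r : ℕ) {G : Set Ω} (hG : MeasurableSet[ℱ r] G)
    {B : Set (Fin d × ℝ)} (hB : MeasurableSet B) :
    μ (G ∩ {ω | (I (r + 1) ω, X (r + 1) ω) ∈ B}) =
      ∫⁻ ω in G, jumpLaw P F (I r ω, X r ω) B ∂μ := by
  have hS : MeasurableSet {ω | (I (r + 1) ω, X (r + 1) ω) ∈ B} := h.measurable_pair' (r + 1) hB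
  have hG' := ℱ.le r G hG
  have h1 := setIntegral_condExp (ℱ.le r)
    ((integrable_const (μ := μ) (1 : ℝ)).indicator hS) hG
  rw [setIntegral_congr_ae hG' ((h.markov r B hB).mono fun ω hω _ => hω),
    setIntegral_indicator hS, setIntegral_const, smul_eq_mul, mul_one] at h1
  have := fun z => isProbabilityMeasure_jumpLaw hP F z
  rw [← ENNReal.ofReal_toReal (measure_ne_top μ (G ∩ _)), ← measureReal_def, ← h1,
    ofReal_integral_eq_lintegral_ofReal]
  · exact lintegral_congr fun ω => ENNReal.ofReal_toReal (measure_ne_top _ _)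
  · refine Integrable.of_bound (C := 1) ?_ (Eventually.of_forall fun ω => ?_)
    · have hm : Measurable fun ω => jumpLaw P F (I r ω, X r ω) B :=
        (Measure.measurable_coe hB).comp ((measurable_jumpLaw P F).comp (h.measurable_pair' r))
      exact hm.ennreal_toReal.aestronglyMeasurable
    · rw [Real.norm_of_nonneg measureReal_nonneg]
      exact measureReal_le_one
  · exact Eventually.of_forall fun ω => measureReal_nonneg

/-- The joint law of two consecutive states, on an event of the past. -/
theorem map_restrict_pair (h : IsMultiplicativeChain P F μ ℱ I X)
    (hP : P ∈ Matrix.rowStochastic ℝ (Fin d)) (r : ℕ) {G : Set Ω} (hG : MeasurableSet[ℱ r] G) :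
    (μ.restrict G).map (fun ω => ((I r ω, X r ω), (I (r + 1) ω, X (r + 1) ω))) =
      ((μ.restrict G).map (fun ω => (I r ω, X r ω))) ⊗ₘ jumpKernel P F := by
  have : IsMarkovKernel (jumpKernel P F) := ⟨fun z => isProbabilityMeasure_jumpLaw hP F z⟩
  have hZ := h.measurable_pair' r
  have hZ' := h.measurable_pair' (r + 1)
  refine Measure.ext_prod fun {s t} hs ht => ?_
  rw [Measure.map_apply (hZ.prodMk hZ') (hs.prod ht), Measure.compProd_apply_prod hs ht,
    Measure.restrict_apply ((hZ.prodMk hZ') (hs.prod ht)),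
    setLIntegral_map hs (Kernel.measurable_coe _ ht) hZ, Measure.restrict_restrict (hZ hs)]
  change _ = ∫⁻ ω in _, jumpLaw P F (I r ω, X r ω) t ∂μ
  rw [← h.measure_inter_eq hP r (((h.measurable_pair r) hs).inter hG) ht]
  congr 1
  ext ω
  simp only [Set.mem_inter_iff, Set.mem_preimage, Set.mem_prod, Set.mem_ofPred_eq]
  tauto

/-- Working in `[0, ∞]` avoids any integrability condition, which matters because the initial law is
arbitrary. -/
theorem setLIntegral_succ (h : IsMultiplicativeChain P F μ ℱ I X)
    (hP : P ∈ Matrix.rowStochastic ℝ (Fin d)) (r : ℕ) {G : Set Ω} (hG : MeasurableSet[ℱ r] G)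
    {f : Fin d × ℝ → ENNReal} (hf : Measurable f) :
    ∫⁻ ω in G, f (I (r + 1) ω, X (r + 1) ω) ∂μ =
      ∫⁻ ω in G, ∑ j, ENNReal.ofReal (P (I r ω) j) *
        ∫⁻ α, f (j, α * X r ω) ∂(F (I r ω) j) ∂μ := by
  have : IsMarkovKernel (jumpKernel P F) := ⟨fun z => isProbabilityMeasure_jumpLaw hP F z⟩
  have hZ := h.measurable_pair' r
  have hZ' := h.measurable_pair' (r + 1)
  have hf' : Measurable fun p : (Fin d × ℝ) × (Fin d × ℝ) => f p.2 := hf.comp measurable_snd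
  calc ∫⁻ ω in G, f (I (r + 1) ω, X (r + 1) ω) ∂μ
      = ∫⁻ p, f p.2 ∂((μ.restrict G).map
          (fun ω => ((I r ω, X r ω), (I (r + 1) ω, X (r + 1) ω)))) := by
        rw [lintegral_map hf' (hZ.prodMk hZ')]
    _ = ∫⁻ ω in G, ∫⁻ u, f u ∂(jumpLaw P F (I r ω, X r ω)) ∂μ := by
        rw [h.map_restrict_pair hP r hG, Measure.lintegral_compProd hf',
          lintegral_map (hf.lintegral_kernel (κ := jumpKernel P F)) hZ]
        rfl
    _ = _ := lintegral_congr fun ω => lintegral_jumpLaw P F _ hf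

theorem ae_pos (h : IsMultiplicativeChain P F μ ℱ I X)
    (hP : P ∈ Matrix.rowStochastic ℝ (Fin d)) (hF : ∀ i j, ∀ᵐ y ∂(F i j), 0 < y) :
    ∀ᵐ ω ∂μ, ∀ r, 0 < X r ω := by
  rw [ae_all_iff]
  intro r
  induction r with
  | zero => exact h.init_pos
  | succ r ih =>
    have hB : MeasurableSet {u : Fin d × ℝ | u.2 ≤ 0} :=
      measurableSet_le measurable_snd measurable_const
    have h1 := h.setLIntegral_succ hP r (G := Set.univ) MeasurableSet.univ
      (f := Set.indicator {u : Fin d × ℝ | u.2 ≤ 0} 1) (measurable_one.indicator hB)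
    have h2 : ∫⁻ ω in Set.univ, ∑ j, ENNReal.ofReal (P (I r ω) j) *
        ∫⁻ α, Set.indicator {u : Fin d × ℝ | u.2 ≤ 0} 1 (j, α * X r ω) ∂(F (I r ω) j) ∂μ = 0 := by
      rw [setLIntegral_univ]
      refine lintegral_eq_zero_of_ae_eq_zero ?_
      filter_upwards [ih] with ω hω
      refine Finset.sum_eq_zero fun j _ => ?_
      rw [lintegral_eq_zero_of_ae_eq_zero, mul_zero]
      filter_upwards [hF (I r ω) j] with α hα
      exact Set.indicator_of_notMem (by simpa using mul_pos hα hω) _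
    have hm : Measurable fun ω => Set.indicator {u : Fin d × ℝ | u.2 ≤ 0}
        (1 : Fin d × ℝ → ENNReal) (I (r + 1) ω, X (r + 1) ω) :=
      (measurable_one.indicator hB).comp (h.measurable_pair' (r + 1))
    rw [h2, setLIntegral_univ, lintegral_eq_zero_iff hm] at h1
    filter_upwards [h1] with ω hω
    by_contra hneg
    have : Set.indicator {u : Fin d × ℝ | u.2 ≤ 0} (1 : Fin d × ℝ → ENNReal)
        (I (r + 1) ω, X (r + 1) ω) = 1 := Set.indicator_of_mem (by simpa using hneg) _
    simp [this] at hω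

/-- Conditional expectation, given the past, of a function of the next transition. -/
theorem condExp_transition (h : IsMultiplicativeChain P F μ ℱ I X)
    (hP : P ∈ Matrix.rowStochastic ℝ (Fin d)) (hpos : ∀ᵐ ω ∂μ, ∀ r, 0 < X r ω)
    {ψ : Fin d → Fin d → ℝ → ℝ} (hψ : ∀ i j, Measurable (ψ i j)) {C : ℝ}
    (hC : ∀ i j y, |ψ i j y| ≤ C) (r : ℕ) :
    μ[fun ω => ψ (I r ω) (I (r + 1) ω) (X (r + 1) ω / X r ω) | ℱ r] =ᵐ[μ]
      fun ω => ∑ j, P (I r ω) j * ∫ y, ψ (I r ω) j y ∂(F (I r ω) j) := by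
  have : IsMarkovKernel (jumpKernel P F) := ⟨fun z => isProbabilityMeasure_jumpLaw hP F z⟩
  have hZ := h.measurable_pair' r
  have hZ' := h.measurable_pair' (r + 1)
  have hψm : Measurable fun q : Fin d × Fin d × ℝ => ψ q.1 q.2.1 q.2.2 :=
    measurable_from_prod_countable_right fun i => measurable_from_prod_countable_right (hψ i)
  have hΦ : Measurable fun p : (Fin d × ℝ) × (Fin d × ℝ) => ψ p.1.1 p.2.1 (p.2.2 / p.1.2) :=
    hψm.comp (by fun_prop :
      Measurable fun p : (Fin d × ℝ) × (Fin d × ℝ) => (p.1.1, p.2.1, p.2.2 / p.1.2))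
  set R : Fin d → ℝ := fun i => ∑ j, P i j * ∫ y, ψ i j y ∂(F i j) with hR
  have hRm : Measurable[ℱ r] fun ω => R (I r ω) := (Measurable.of_discrete (f := R)).comp (h.adapted_fst r)
  have hRint : Integrable (fun ω => R (I r ω)) μ := by
    refine Integrable.of_bound (hRm.mono (ℱ.le r) le_rfl).aestronglyMeasurable
      (∑ i, ‖R i‖) (Eventually.of_forall fun ω => ?_)
    exact Finset.single_le_sum (f := fun i => ‖R i‖) (fun _ _ => norm_nonneg _)
      (Finset.mem_univ _)
  refine (ae_eq_condExp_of_forall_setIntegral_eq (ℱ.le r) ?_ (fun _ _ _ => hRint.integrableOn)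
    (fun G hG _ => ?_) hRm.stronglyMeasurable.aestronglyMeasurable).symm
  · exact Integrable.of_bound (hΦ.comp (hZ.prodMk hZ')).aestronglyMeasurable C
      (Eventually.of_forall fun ω => hC _ _ _)
  · symm
    -- The joint law is disintegrated along the kernel. Since `X r > 0`, dividing `α * X r` by `X r`
    -- recovers the multiplier, and the result depends on `I r` alone.
    calc ∫ ω in G, ψ (I r ω) (I (r + 1) ω) (X (r + 1) ω / X r ω) ∂μ
        = ∫ p, ψ p.1.1 p.2.1 (p.2.2 / p.1.2) ∂((μ.restrict G).map
            (fun ω => ((I r ω, X r ω), (I (r + 1) ω, X (r + 1) ω)))) := by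
          rw [integral_map (hZ.prodMk hZ').aemeasurable hΦ.aestronglyMeasurable]
      _ = ∫ ω in G, ∫ u, ψ (I r ω) u.1 (u.2 / X r ω) ∂(jumpLaw P F (I r ω, X r ω)) ∂μ := by
          have := Measure.isFiniteMeasure_map (μ.restrict G) (fun ω => (I r ω, X r ω))
          rw [h.map_restrict_pair hP r hG, Measure.integral_compProd
            (Integrable.of_bound hΦ.aestronglyMeasurable C (Eventually.of_forall fun p =>
              hC _ _ _)), integral_map hZ.aemeasurable]
          · rfl
          · exact (hΦ.stronglyMeasurable.integral_kernel_prod_right'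
              (κ := jumpKernel P F)).aestronglyMeasurable
      _ = ∫ ω in G, R (I r ω) ∂μ := by
          refine setIntegral_congr_ae (ℱ.le r G hG) ?_
          filter_upwards [hpos] with ω hω _
          have hψr : Measurable fun u : Fin d × ℝ => ψ (I r ω) u.1 (u.2 / X r ω) :=
            hψm.comp (by fun_prop : Measurable fun u : Fin d × ℝ => (I r ω, u.1, u.2 / X r ω))
          rw [integral_jumpLaw hP.1 F _ hψr (fun u => hC _ _ _)]
          refine Finset.sum_congr rfl fun j _ => ?_
          simp only [mul_div_cancel_right₀ _ (hω r).ne']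

end IsMultiplicativeChain

end MultiplicativeModel

/-! ### Weighted moments, nonzero drift and the moments of the total time -/

namespace MultiplicativeModel

theorem sum_rpow_le_of_le_one {s : ℝ} (hs : 0 < s) (hs1 : s ≤ 1) (f : ℕ → ENNReal) (n : ℕ) :
    (∑ r ∈ Finset.range n, f r) ^ s ≤ ∑ r ∈ Finset.range n, f r ^ s := by
  induction n with
  | zero => simp [hs]
  | succ n ih =>
    rw [Finset.sum_range_succ, Finset.sum_range_succ]
    exact (ENNReal.rpow_add_le_add_rpow _ _ hs.le hs1).trans (by gcongr)

theorem tendsto_sum_rpow (s : ℝ) (f : ℕ → ENNReal) :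
    Tendsto (fun n => (∑ r ∈ Finset.range n, f r) ^ s) atTop (𝓝 ((∑' r, f r) ^ s)) :=
  (ENNReal.continuous_rpow_const.tendsto _).comp (ENNReal.tendsto_nat_tsum f)

theorem tsum_rpow_le_of_le_one {s : ℝ} (hs : 0 < s) (hs1 : s ≤ 1) (f : ℕ → ENNReal) :
    (∑' r, f r) ^ s ≤ ∑' r, f r ^ s :=
  le_of_tendsto' (tendsto_sum_rpow s f) fun n =>
    (sum_rpow_le_of_le_one hs hs1 f n).trans (ENNReal.sum_le_tsum _)

/-- Minkowski's inequality for finite sums of nonnegative functions. -/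
theorem lintegral_sum_rpow_le {Ω : Type*} [MeasurableSpace Ω] (μ : Measure Ω) {s : ℝ}
    (hs : 1 ≤ s) {f : ℕ → Ω → ENNReal} (hf : ∀ r, Measurable (f r)) (n : ℕ) :
    (∫⁻ ω, (∑ r ∈ Finset.range n, f r ω) ^ s ∂μ) ^ (1 / s) ≤
      ∑ r ∈ Finset.range n, (∫⁻ ω, f r ω ^ s ∂μ) ^ (1 / s) := by
  have hs0 : 0 < s := by linarith
  induction n with
  | zero => simp [hs0]
  | succ n ih =>
    simp only [Finset.sum_range_succ]
    have h := ENNReal.lintegral_Lp_add_le (μ := μ)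
      (f := fun ω => ∑ r ∈ Finset.range n, f r ω) (g := f n)
      (Finset.measurable_sum _ fun r _ => hf r).aemeasurable (hf n).aemeasurable hs
    exact h.trans (by gcongr)

theorem tsum_const_mul_geometric_lt_top {C θ : ENNReal} (hC : C ≠ ⊤) (hθ : θ < 1) :
    ∑' r : ℕ, C * θ ^ r < ⊤ := by
  rw [ENNReal.tsum_mul_left, ENNReal.tsum_geometric]
  exact ENNReal.mul_lt_top hC.lt_top (ENNReal.inv_lt_top.2 (tsub_pos_of_lt hθ))

/-- For `s ≤ 1` the power passes inside the sum by subadditivity. For `s ≥ 1` the `L^s` norms decay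
like `θ^(r/s)`, and Minkowski followed by monotone convergence applies. Both bounds are geometric
series. -/
theorem lintegral_tsum_rpow_lt_top {Ω : Type*} [MeasurableSpace Ω] (μ : Measure Ω) {s : ℝ}
    (hs : 0 < s) {f : ℕ → Ω → ENNReal} (hf : ∀ r, Measurable (f r)) {C θ : ENNReal}
    (hC : C ≠ ⊤) (hθ : θ < 1) (h : ∀ r, ∫⁻ ω, f r ω ^ s ∂μ ≤ C * θ ^ r) :
    ∫⁻ ω, (∑' r, f r ω) ^ s ∂μ < ⊤ := by
  rcases le_total s 1 with hs1 | hs1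
  · calc ∫⁻ ω, (∑' r, f r ω) ^ s ∂μ ≤ ∫⁻ ω, ∑' r, f r ω ^ s ∂μ :=
          lintegral_mono fun ω => tsum_rpow_le_of_le_one hs hs1 _
      _ = ∑' r, ∫⁻ ω, f r ω ^ s ∂μ := lintegral_tsum fun r => ((hf r).pow_const s).aemeasurable
      _ ≤ ∑' r, C * θ ^ r := ENNReal.tsum_le_tsum h
      _ < ⊤ := tsum_const_mul_geometric_lt_top hC hθ
  · have hs' : 0 < 1 / s := one_div_pos.2 hs
    set B := ∑' r : ℕ, C ^ (1 / s) * (θ ^ (1 / s)) ^ r with hB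
    have hBtop : B < ⊤ := tsum_const_mul_geometric_lt_top (ENNReal.rpow_ne_top_of_nonneg hs'.le hC)
      (ENNReal.rpow_lt_one hθ hs')
    have hn : ∀ n, ∫⁻ ω, (∑ r ∈ Finset.range n, f r ω) ^ s ∂μ ≤ B ^ s := by
      intro n
      have h1 := lintegral_sum_rpow_le μ hs1 hf n
      have h2 : ∑ r ∈ Finset.range n, (∫⁻ ω, f r ω ^ s ∂μ) ^ (1 / s) ≤ B := by
        refine (Finset.sum_le_sum fun r _ => ?_).trans (ENNReal.sum_le_tsum _)
        refine (ENNReal.rpow_le_rpow (h r) hs'.le).trans_eq ?_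
        rw [ENNReal.mul_rpow_of_nonneg _ _ hs'.le, ← ENNReal.rpow_natCast, ← ENNReal.rpow_mul,
          mul_comm (r : ℝ), ENNReal.rpow_mul, ENNReal.rpow_natCast]
      have h3 := ENNReal.rpow_le_rpow (h1.trans h2) hs.le
      rwa [← ENNReal.rpow_mul, one_div_mul_cancel hs.ne', ENNReal.rpow_one] at h3
    refine (le_of_tendsto' (lintegral_tendsto_of_tendsto_of_monotone
      (fun n => ((Finset.measurable_sum _ fun r _ => hf r).pow_const s).aemeasurable)
      (Eventually.of_forall fun ω a b hab => ?_)
      (Eventually.of_forall fun ω => tendsto_sum_rpow s fun r => f r ω)) hn).trans_lt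
      (ENNReal.rpow_lt_top_of_nonneg hs.le hBtop.ne)
    exact ENNReal.rpow_le_rpow (Finset.sum_le_sum_of_subset (Finset.range_mono hab)) hs.le

variable {d : ℕ} {Ω : Type*} [mΩ : MeasurableSpace Ω]
  {P : Matrix (Fin d) (Fin d) ℝ} {F : Fin d → Fin d → Measure ℝ}
  [∀ i j, IsProbabilityMeasure (F i j)] {μ : Measure Ω} [IsProbabilityMeasure μ]
  {ℱ : Filtration ℕ mΩ} {I : ℕ → Ω → Fin d} {X : ℕ → Ω → ℝ}

namespace IsMultiplicativeChain

theorem ae_value_pos (h : IsMultiplicativeChain P F μ ℱ I X)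
    (hP : P ∈ Matrix.rowStochastic ℝ (Fin d)) (hF : BoundedMultipliers F) :
    ∀ᵐ ω ∂μ, ∀ r, 0 < X r ω := by
  obtain ⟨K, hK⟩ := hF.exists_abs_log_le
  exact h.ae_pos hP fun i j => (hK i j).mono fun y hy => hy.1

/-- Since `(α x)^s = α^s x^s`, the dependence on `x` factors out and one step of the chain acts on
the weight `w` as the matrix `M(s)`. The exponent may be negative, which serves positive drift. -/
theorem setLIntegral_weight_succ (h : IsMultiplicativeChain P F μ ℱ I X)
    (hP : P ∈ Matrix.rowStochastic ℝ (Fin d)) (hF : BoundedMultipliers F) (s : ℝ)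
    {w : Fin d → ℝ} (hw : ∀ i, 0 < w i) (r : ℕ) {G : Set Ω} (hG : MeasurableSet[ℱ r] G) :
    ∫⁻ ω in G, ENNReal.ofReal (w (I (r + 1) ω) * X (r + 1) ω ^ s) ∂μ =
      ∫⁻ ω in G, ENNReal.ofReal ((momentMatrix P F s).mulVec w (I r ω) * X r ω ^ s) ∂μ := by
  obtain ⟨K, hK⟩ := hF.exists_abs_log_le
  have hf : Measurable fun u : Fin d × ℝ => ENNReal.ofReal (w u.1 * u.2 ^ s) := by
    refine measurable_from_prod_countable_right fun i => ?_
    fun_prop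
  rw [h.setLIntegral_succ hP r hG hf]
  refine setLIntegral_congr_fun_ae (ℱ.le r G hG) ?_
  filter_upwards [h.ae_value_pos hP hF] with ω hω _
  have hx := hω r
  rw [mulVec_eq_sum, Finset.sum_mul, ENNReal.ofReal_sum_of_nonneg]
  · refine Finset.sum_congr rfl fun j _ => ?_
    have hj : ∫⁻ α, ENNReal.ofReal (w j * (α * X r ω) ^ s) ∂(F (I r ω) j) =
        ENNReal.ofReal (∫ α, α ^ s * (w j * X r ω ^ s) ∂(F (I r ω) j)) := by
      rw [ofReal_integral_eq_lintegral_ofReal ((integrable_rpow hF s _ _).mul_const _)]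
      · refine lintegral_congr_ae ?_
        filter_upwards [hK (I r ω) j] with α hα
        rw [Real.mul_rpow hα.1.le hx.le]
        ring_nf
      · filter_upwards [hK (I r ω) j] with α hα
        exact mul_nonneg (Real.rpow_nonneg hα.1.le s)
          (mul_nonneg (hw j).le (Real.rpow_nonneg hx.le s))
    rw [hj, ← ENNReal.ofReal_mul (Matrix.nonneg_of_mem_rowStochastic hP), integral_mul_const]
    congr 1
    simp only [momentMatrix, Matrix.of_apply]
    ring
  · intro j _
    exact mul_nonneg (mul_nonneg (mul_nonneg (Matrix.nonneg_of_mem_rowStochastic hP)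
      (integral_rpow_pos hF s _ _).le) (hw j).le) (Real.rpow_nonneg hx.le s)

theorem setLIntegral_weight_le (h : IsMultiplicativeChain P F μ ℱ I X)
    (hP : P ∈ Matrix.rowStochastic ℝ (Fin d)) (hF : BoundedMultipliers F) {s ρ : ℝ}
    {w : Fin d → ℝ} (hw : ∀ i, 0 < w i) (hρ : ∀ i, (momentMatrix P F s).mulVec w i ≤ ρ * w i)
    (r : ℕ) {G : Set Ω} (hG : MeasurableSet[ℱ 0] G) :
    ∫⁻ ω in G, ENNReal.ofReal (w (I r ω) * X r ω ^ s) ∂μ ≤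
      ENNReal.ofReal ρ ^ r * ∫⁻ ω in G, ENNReal.ofReal (w (I 0 ω) * X 0 ω ^ s) ∂μ := by
  induction r with
  | zero => simp
  | succ r ih =>
    rw [h.setLIntegral_weight_succ hP hF s hw r (ℱ.mono (Nat.zero_le r) G hG), pow_succ',
      mul_assoc]
    refine le_trans ?_ (mul_le_mul_right ih _)
    rw [← lintegral_const_mul' _ _ ENNReal.ofReal_ne_top]
    refine setLIntegral_mono_ae' (ℱ.le 0 G hG) ?_
    filter_upwards [h.ae_value_pos hP hF] with ω hω _
    have hx := Real.rpow_nonneg (hω r).le s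
    -- Only the second factor has to be nonnegative, so `ρ` needs no sign condition.
    rw [← ENNReal.ofReal_mul' (mul_nonneg (hw _).le hx), ← mul_assoc]
    exact ENNReal.ofReal_le_ofReal (mul_le_mul_of_nonneg_right (hρ _) hx)

theorem le_lintegral_weight (h : IsMultiplicativeChain P F μ ℱ I X)
    (hP : P ∈ Matrix.rowStochastic ℝ (Fin d)) (hF : BoundedMultipliers F) {s : ℝ}
    {w : Fin d → ℝ} (hw : ∀ i, 0 < w i) (hle : ∀ i, w i ≤ (momentMatrix P F s).mulVec w i)
    (r : ℕ) : ∫⁻ ω, ENNReal.ofReal (w (I 0 ω) * X 0 ω ^ s) ∂μ ≤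
      ∫⁻ ω, ENNReal.ofReal (w (I r ω) * X r ω ^ s) ∂μ := by
  induction r with
  | zero => exact le_rfl
  | succ r ih =>
    have h1 := h.setLIntegral_weight_succ hP hF s hw r MeasurableSet.univ
    rw [setLIntegral_univ, setLIntegral_univ] at h1
    rw [h1]
    refine ih.trans (lintegral_mono_ae ?_)
    filter_upwards [h.ae_value_pos hP hF] with ω hω
    exact ENNReal.ofReal_le_ofReal
      (mul_le_mul_of_nonneg_right (hle _) (Real.rpow_nonneg (hω r).le s))

/-- On finitely many states the weight is comparable to a constant; the comparison costs `C = (∑ 1 /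
w_i)(∑ w_i)`. Events `G` of time `0` are kept for localisation. -/
theorem exists_setLIntegral_rpow_le (h : IsMultiplicativeChain P F μ ℱ I X)
    (hP : P ∈ Matrix.rowStochastic ℝ (Fin d)) (hF : BoundedMultipliers F) {s ρ : ℝ}
    {w : Fin d → ℝ} (hw : ∀ i, 0 < w i)
    (hρ : ∀ i, (momentMatrix P F s).mulVec w i ≤ ρ * w i) :
    ∃ C : ENNReal, C ≠ ⊤ ∧ ∀ (r : ℕ) (G : Set Ω), MeasurableSet[ℱ 0] G →
      ∫⁻ ω in G, ENNReal.ofReal (X r ω ^ s) ∂μ ≤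
        C * (∫⁻ ω in G, ENNReal.ofReal (X 0 ω ^ s) ∂μ) * ENNReal.ofReal ρ ^ r := by
  set a : ENNReal := ∑ i, ENNReal.ofReal (w i)⁻¹ with ha
  set b : ENNReal := ∑ i, ENNReal.ofReal (w i) with hb
  have hatop : a ≠ ⊤ := ENNReal.sum_ne_top.2 fun _ _ => ENNReal.ofReal_ne_top
  have hbtop : b ≠ ⊤ := ENNReal.sum_ne_top.2 fun _ _ => ENNReal.ofReal_ne_top
  refine ⟨a * b, ENNReal.mul_ne_top hatop hbtop, fun r G hG => ?_⟩
  have h1 : ∀ i (x : ℝ), ENNReal.ofReal x ≤ a * ENNReal.ofReal (w i * x) := fun i x => by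
    have : ENNReal.ofReal (w i)⁻¹ ≤ a :=
      Finset.single_le_sum (f := fun i => ENNReal.ofReal (w i)⁻¹) (fun _ _ => zero_le)
        (Finset.mem_univ i)
    refine le_trans ?_ (mul_le_mul_left this _)
    rw [← ENNReal.ofReal_mul (inv_nonneg.2 (hw i).le), inv_mul_cancel_left₀ (hw i).ne']
  have h2 : ∀ i (x : ℝ), ENNReal.ofReal (w i * x) ≤ b * ENNReal.ofReal x := fun i x => by
    rw [ENNReal.ofReal_mul (hw i).le]
    exact mul_le_mul_left (Finset.single_le_sum (f := fun i => ENNReal.ofReal (w i))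
      (fun _ _ => zero_le) (Finset.mem_univ i)) _
  calc ∫⁻ ω in G, ENNReal.ofReal (X r ω ^ s) ∂μ
      ≤ ∫⁻ ω in G, a * ENNReal.ofReal (w (I r ω) * X r ω ^ s) ∂μ :=
        lintegral_mono fun ω => h1 _ _
    _ = a * ∫⁻ ω in G, ENNReal.ofReal (w (I r ω) * X r ω ^ s) ∂μ :=
        lintegral_const_mul' _ _ hatop
    _ ≤ a * (ENNReal.ofReal ρ ^ r * ∫⁻ ω in G, b * ENNReal.ofReal (X 0 ω ^ s) ∂μ) := by
        gcongr
        exact (h.setLIntegral_weight_le hP hF hw hρ r hG).trans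
          (mul_le_mul_right (lintegral_mono fun ω => h2 _ _) _)
    _ = a * b * (∫⁻ ω in G, ENNReal.ofReal (X 0 ω ^ s) ∂μ) * ENNReal.ofReal ρ ^ r := by
        rw [lintegral_const_mul' _ _ hbtop]
        ring

/-- `X_0^s` need not be integrable, so the expectation bound is applied on each event `X_0^s ≤ K`,
and these exhaust the space. -/
theorem ae_tsum_rpow_lt_top (h : IsMultiplicativeChain P F μ ℱ I X)
    (hP : P ∈ Matrix.rowStochastic ℝ (Fin d)) (hF : BoundedMultipliers F) {s ρ : ℝ} (hρ1 : ρ < 1)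
    {w : Fin d → ℝ} (hw : ∀ i, 0 < w i)
    (hρ : ∀ i, (momentMatrix P F s).mulVec w i ≤ ρ * w i) :
    ∀ᵐ ω ∂μ, ∑' r, ENNReal.ofReal (X r ω ^ s) < ⊤ := by
  obtain ⟨C, hC, hle⟩ := h.exists_setLIntegral_rpow_le hP hF hw hρ
  have hmeas : ∀ r, Measurable fun ω => ENNReal.ofReal (X r ω ^ s) := fun r =>
    ((h.measurable_value r).pow_const s).ennreal_ofReal
  have hK : ∀ K : ℕ, ∀ᵐ ω ∂μ, X 0 ω ^ s ≤ K → ∑' r, ENNReal.ofReal (X r ω ^ s) < ⊤ := by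
    intro K
    have hG : MeasurableSet[ℱ 0] {ω | X 0 ω ^ s ≤ K} :=
      measurableSet_le ((h.adapted_snd 0).pow_const s) measurable_const
    refine (ae_restrict_iff' (ℱ.le 0 _ hG)).1 (ae_lt_top (Measurable.tsum hmeas) ?_)
    rw [lintegral_tsum fun r => (hmeas r).aemeasurable]
    refine ((ENNReal.tsum_le_tsum fun r => hle r _ hG).trans_lt
      (tsum_const_mul_geometric_lt_top (ENNReal.mul_ne_top hC ?_) (by simpa using hρ1))).ne
    refine ((setLIntegral_mono' (ℱ.le 0 _ hG) (g := fun _ => ENNReal.ofReal K)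
      fun ω hω => ENNReal.ofReal_le_ofReal hω).trans_lt ?_).ne
    rw [setLIntegral_const]
    exact ENNReal.mul_lt_top ENNReal.ofReal_lt_top (measure_lt_top _ _)
  filter_upwards [ae_all_iff.2 hK] with ω hω
  obtain ⟨K, hK⟩ := exists_nat_ge (X 0 ω ^ s)
  exact hω K hK

theorem ae_tendsto_rpow (h : IsMultiplicativeChain P F μ ℱ I X)
    (hP : P ∈ Matrix.rowStochastic ℝ (Fin d)) (hF : BoundedMultipliers F) {s ρ : ℝ} (hρ1 : ρ < 1)
    {w : Fin d → ℝ} (hw : ∀ i, 0 < w i)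
    (hρ : ∀ i, (momentMatrix P F s).mulVec w i ≤ ρ * w i) :
    ∀ᵐ ω ∂μ, Tendsto (fun r => X r ω ^ s) atTop (𝓝 0) := by
  filter_upwards [h.ae_tsum_rpow_lt_top hP hF hρ1 hw hρ, h.ae_value_pos hP hF] with ω hω hpos
  have h1 := (ENNReal.tendsto_toReal ENNReal.zero_ne_top).comp
    (ENNReal.tendsto_atTop_zero_of_tsum_ne_top hω.ne)
  refine h1.congr fun r => ?_
  exact ENNReal.toReal_ofReal (Real.rpow_nonneg (hpos r).le s)

variable {v : Fin d → ℝ}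

theorem ae_tendsto_zero_and_totalTime_lt_top (h : IsMultiplicativeChain P F μ ℱ I X)
    (hP : P ∈ Matrix.rowStochastic ℝ (Fin d)) (hirr : P.IsIrreducible)
    (hF : BoundedMultipliers F) (hv : IsEquilibrium P v)
    (hm : ∑ i, v i * meanLog P F i < 0) :
    ∀ᵐ ω ∂μ, Tendsto (fun r => X r ω) atTop (𝓝 0) ∧ totalTime X ω < ⊤ := by
  obtain ⟨δ, hδm, hδ1, ρ, hρ1, w, hw, hρ⟩ := exists_contraction hP hirr hF hv hm.ne
  have hδ : 0 < δ := by
    by_contra hneg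
    exact absurd (mul_nonneg_of_nonpos_of_nonpos (not_lt.1 hneg) hm.le) (not_le.2 hδm)
  filter_upwards [h.ae_tsum_rpow_lt_top hP hF hρ1 hw hρ, h.ae_tendsto_rpow hP hF hρ1 hw hρ,
    h.ae_value_pos hP hF] with ω hsum htend hpos
  constructor
  · have h1 := htend.rpow_const (p := δ⁻¹) (Or.inr (inv_nonneg.2 hδ.le))
    rw [Real.zero_rpow (inv_ne_zero hδ.ne')] at h1
    exact h1.congr fun r => Real.rpow_rpow_inv (hpos r).le hδ.ne'
  -- Subadditivity of `x ↦ x^δ` needs `δ ≤ 1`, which is why the contraction supplies `|δ| ≤ 1`.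
  · have h1 : totalTime X ω ^ δ < ⊤ := by
      refine (tsum_rpow_le_of_le_one hδ (abs_le.1 hδ1).2 _).trans_lt (lt_of_le_of_lt ?_ hsum)
      rw [tsum_eq_zero_add' (f := fun r => ENNReal.ofReal (X r ω ^ δ)) ENNReal.summable]
      refine le_trans (ENNReal.tsum_le_tsum fun r => ?_) le_add_self
      rw [ENNReal.ofReal_rpow_of_pos (hpos _)]
    exact (ENNReal.rpow_lt_top_iff_of_pos hδ).1 h1

theorem ae_tendsto_atTop (h : IsMultiplicativeChain P F μ ℱ I X)
    (hP : P ∈ Matrix.rowStochastic ℝ (Fin d)) (hirr : P.IsIrreducible)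
    (hF : BoundedMultipliers F) (hv : IsEquilibrium P v)
    (hm : 0 < ∑ i, v i * meanLog P F i) :
    ∀ᵐ ω ∂μ, Tendsto (fun r => X r ω) atTop atTop := by
  obtain ⟨δ, hδm, -, ρ, hρ1, w, hw, hρ⟩ := exists_contraction hP hirr hF hv hm.ne'
  have hδ : δ < 0 := by
    by_contra hneg
    exact absurd (mul_nonneg (not_lt.1 hneg) hm.le) (not_le.2 hδm)
  filter_upwards [h.ae_tendsto_rpow hP hF hρ1 hw hρ, h.ae_value_pos hP hF] with ω htend hpos
  -- Here `δ < 0`, so `X_r^δ → 0` through positive values says that `X_r^(-δ) → ∞`.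
  have h1 : Tendsto (fun r => (X r ω ^ δ)⁻¹) atTop atTop :=
    (tendsto_nhdsWithin_iff.2 ⟨htend, Eventually.of_forall fun r =>
      Real.rpow_pos_of_pos (hpos r) δ⟩).inv_tendsto_nhdsGT_zero
  refine ((tendsto_rpow_atTop (inv_pos.2 (neg_pos.2 hδ))).comp h1).congr fun r => ?_
  rw [Function.comp, ← Real.rpow_neg (hpos r).le,
    Real.rpow_rpow_inv (hpos r).le (neg_ne_zero.2 hδ.ne)]

theorem lintegral_ofReal_rpow (h : IsMultiplicativeChain P F μ ℱ I X)
    (hP : P ∈ Matrix.rowStochastic ℝ (Fin d)) (hF : BoundedMultipliers F) (s : ℝ) (r : ℕ) :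
    ∫⁻ ω, ENNReal.ofReal (X r ω) ^ s ∂μ = ∫⁻ ω, ENNReal.ofReal (X r ω ^ s) ∂μ := by
  refine lintegral_congr_ae ?_
  filter_upwards [h.ae_value_pos hP hF] with ω hω using ENNReal.ofReal_rpow_of_pos (hω r)

theorem lintegral_totalTime_rpow_lt_top (h : IsMultiplicativeChain P F μ ℱ I X)
    (hP : P ∈ Matrix.rowStochastic ℝ (Fin d)) (hF : BoundedMultipliers F) {s η : ℝ} (hs : 0 < s)
    (hη1 : η < 1) {w : Fin d → ℝ} (hw : ∀ i, 0 < w i)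
    (hη : (momentMatrix P F s).mulVec w = η • w)
    (h0 : ∫⁻ ω, ENNReal.ofReal (X 0 ω) ^ s ∂μ < ⊤) :
    ∫⁻ ω, totalTime X ω ^ s ∂μ < ⊤ := by
  obtain ⟨C, hC, hle⟩ := h.exists_setLIntegral_rpow_le hP hF hw
    (fun i => (congrFun hη i).le)
  rw [h.lintegral_ofReal_rpow hP hF] at h0
  have hη1' : ENNReal.ofReal η < 1 := by simpa using hη1
  refine lintegral_tsum_rpow_lt_top μ hs (fun r => (h.measurable_value (r + 1)).ennreal_ofReal)
    (ENNReal.mul_ne_top hC h0.ne) hη1' fun r => ?_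
  have h1 := hle (r + 1) Set.univ MeasurableSet.univ
  rw [setLIntegral_univ, setLIntegral_univ] at h1
  rw [h.lintegral_ofReal_rpow hP hF]
  -- The total time starts at `X_1`, so the bound carries `η^(r+1)`, which is at most `η^r`.
  refine h1.trans (mul_le_mul_right ?_ _)
  exact pow_le_pow_right_of_le_one' hη1'.le (Nat.le_succ r)

/-- A finite `E T^s` would make `T^s` a dominating function for `X_r^s → 0`, while `η ≥ 1` keeps the
weighted moment above its initial value. -/
theorem lintegral_totalTime_rpow_eq_top (h : IsMultiplicativeChain P F μ ℱ I X)
    (hP : P ∈ Matrix.rowStochastic ℝ (Fin d)) (hF : BoundedMultipliers F) {s η : ℝ} (hs : 0 < s)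
    (hη1 : 1 ≤ η) {w : Fin d → ℝ} (hw : ∀ i, 0 < w i)
    (hη : (momentMatrix P F s).mulVec w = η • w)
    (htend : ∀ᵐ ω ∂μ, Tendsto (fun r => X r ω) atTop (𝓝 0)) :
    ∫⁻ ω, totalTime X ω ^ s ∂μ = ⊤ := by
  by_contra hne
  have hle : ∀ i, w i ≤ (momentMatrix P F s).mulVec w i := fun i => by
    rw [hη]
    exact le_mul_of_one_le_left (hw i).le hη1
  set b : ENNReal := ∑ i, ENNReal.ofReal (w i) with hb
  have hbtop : b ≠ ⊤ := ENNReal.sum_ne_top.2 fun _ _ => ENNReal.ofReal_ne_top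
  have hlow : ∀ r, ∫⁻ ω, ENNReal.ofReal (w (I 0 ω) * X 0 ω ^ s) ∂μ ≤
      b * ∫⁻ ω, ENNReal.ofReal (X (r + 1) ω) ^ s ∂μ := fun r => by
    rw [h.lintegral_ofReal_rpow hP hF, ← lintegral_const_mul' _ _ hbtop]
    refine (h.le_lintegral_weight hP hF hw hle (r + 1)).trans (lintegral_mono fun ω => ?_)
    rw [ENNReal.ofReal_mul (hw _).le]
    exact mul_le_mul_left (Finset.single_le_sum (f := fun i => ENNReal.ofReal (w i))
      (fun _ _ => zero_le) (Finset.mem_univ _)) _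
  have hlim : Tendsto (fun r => ∫⁻ ω, ENNReal.ofReal (X (r + 1) ω) ^ s ∂μ) atTop
      (𝓝 (∫⁻ _, 0 ∂μ)) := by
    refine tendsto_lintegral_of_dominated_convergence (fun ω => totalTime X ω ^ s)
      (fun r => (h.measurable_value (r + 1)).ennreal_ofReal.pow_const s)
      (fun r => Eventually.of_forall fun ω => ?_) hne ?_
    · exact ENNReal.rpow_le_rpow
        (ENNReal.le_tsum (f := fun r => ENNReal.ofReal (X (r + 1) ω)) r) hs.le
    · filter_upwards [htend] with ω hω
      have h1 := ((ENNReal.continuous_rpow_const (y := s)).tendsto _).comp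
        ((ENNReal.tendsto_ofReal hω).comp (tendsto_add_atTop_nat 1))
      simpa [ENNReal.zero_rpow_of_pos hs, Function.comp_def] using h1
  have hlim2 := ENNReal.Tendsto.const_mul hlim (Or.inr hbtop)
  rw [lintegral_zero, mul_zero] at hlim2
  -- The lower bound does not depend on `r`, so the limit forces the initial weighted moment to
  -- vanish, against `X_0 > 0`.
  have hzero := le_antisymm (ge_of_tendsto' hlim2 hlow) zero_le
  have hmeas : Measurable fun ω => ENNReal.ofReal (w (I 0 ω) * X 0 ω ^ s) :=
    (((Measurable.of_discrete (f := w)).comp (h.measurable_state 0)).mul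
      ((h.measurable_value 0).pow_const s)).ennreal_ofReal
  rw [lintegral_eq_zero_iff hmeas] at hzero
  obtain ⟨ω, hω1, hω2⟩ := (hzero.and h.init_pos).exists
  have := mul_pos (hw (I 0 ω)) (Real.rpow_pos_of_pos hω2 s)
  exact absurd (ENNReal.ofReal_eq_zero.1 hω1) (not_le.2 this)

end IsMultiplicativeChain

end MultiplicativeModel

/-! ### Recurrence and the zero-drift case -/

namespace MultiplicativeModel

variable {d : ℕ} {Ω : Type*} [mΩ : MeasurableSpace Ω]
  {P : Matrix (Fin d) (Fin d) ℝ} {F : Fin d → Fin d → Measure ℝ}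
  [∀ i j, IsProbabilityMeasure (F i j)] {μ : Measure Ω} [IsProbabilityMeasure μ]
  {ℱ : Filtration ℕ mΩ} {I : ℕ → Ω → Fin d} {X : ℕ → Ω → ℝ}

theorem exists_jump_of_not_isDegenerate {g : Fin d → ℝ} (hF : BoundedMultipliers F)
    (hdeg : ¬ IsDegenerate P F) :
    ∃ i j, 0 < P i j ∧ ∃ ε > 0, 0 < (F i j).real {y | ε ≤ |Real.log y + (g j - g i)|} := by
  by_contra! hno
  obtain ⟨K, hK⟩ := hF.exists_abs_log_le
  -- If no centred jump is nonzero, then `log y = g i - g j`, which is the degenerate form with `c i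
  -- = exp (-g i)`.
  refine hdeg ⟨fun i => Real.exp (-g i), fun i => Real.exp_pos _, fun i j hij => ?_⟩
  have h1 : ∀ n : ℕ, ∀ᵐ y ∂(F i j), ¬ (1 / ((n : ℝ) + 1) ≤ |Real.log y + (g j - g i)|) := by
    intro n
    have h2 := le_antisymm (hno i j hij (1 / ((n : ℝ) + 1)) Nat.one_div_pos_of_nat)
      measureReal_nonneg
    exact measure_eq_zero_iff_ae_notMem.1 ((measureReal_eq_zero_iff).1 h2)
  filter_upwards [ae_all_iff.2 h1, hK i j] with y hy hKy
  have h3 : Real.log y + (g j - g i) = 0 := by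
    by_contra hne
    obtain ⟨n, hn⟩ := exists_nat_one_div_lt (abs_pos.2 hne)
    exact hy n hn.le
  rw [← Real.exp_sub, ← Real.exp_log hKy.1]
  congr 1
  linarith

namespace IsMultiplicativeChain

theorem measurable_transition (h : IsMultiplicativeChain P F μ ℱ I X)
    {ψ : Fin d → Fin d → ℝ → ℝ} (hψ : ∀ i j, Measurable (ψ i j)) (r : ℕ) :
    Measurable[ℱ (r + 1)] fun ω => ψ (I r ω) (I (r + 1) ω) (X (r + 1) ω / X r ω) := by
  have hψm : Measurable fun q : Fin d × Fin d × ℝ => ψ q.1 q.2.1 q.2.2 :=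
    measurable_from_prod_countable_right fun i => measurable_from_prod_countable_right (hψ i)
  have hle := ℱ.mono (Nat.le_succ r)
  exact hψm.comp (((h.adapted_fst r).mono hle le_rfl).prodMk ((h.adapted_fst (r + 1)).prodMk
    ((h.adapted_snd (r + 1)).div ((h.adapted_snd r).mono hle le_rfl))))

theorem integrable_transition (h : IsMultiplicativeChain P F μ ℱ I X)
    {ψ : Fin d → Fin d → ℝ → ℝ} (hψ : ∀ i j, Measurable (ψ i j)) {C : ℝ}
    (hC : ∀ i j y, |ψ i j y| ≤ C) (r : ℕ) :
    Integrable (fun ω => ψ (I r ω) (I (r + 1) ω) (X (r + 1) ω / X r ω)) μ :=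
  Integrable.of_bound ((h.measurable_transition hψ r).mono (ℱ.le _) le_rfl).aestronglyMeasurable C
    (Eventually.of_forall fun _ => hC _ _ _)

/-- Almost sure properties of the multipliers hold along almost every trajectory. -/
theorem ae_forall_transition (h : IsMultiplicativeChain P F μ ℱ I X)
    (hP : P ∈ Matrix.rowStochastic ℝ (Fin d)) (hF : BoundedMultipliers F)
    {Q : Fin d → Fin d → Set ℝ} (hQm : ∀ i j, MeasurableSet (Q i j))
    (hQ : ∀ i j, ∀ᵐ y ∂(F i j), y ∈ Q i j) :
    ∀ᵐ ω ∂μ, ∀ r, X (r + 1) ω / X r ω ∈ Q (I r ω) (I (r + 1) ω) := by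
  rw [ae_all_iff]
  intro r
  set ψ : Fin d → Fin d → ℝ → ℝ := fun i j => (Q i j)ᶜ.indicator 1 with hψ
  have hψm : ∀ i j, Measurable (ψ i j) := fun i j => measurable_one.indicator (hQm i j).compl
  have hψ0 : ∀ i j y, 0 ≤ ψ i j y := fun i j y => Set.indicator_nonneg (fun _ _ => zero_le_one) y
  have hψ1 : ∀ i j y, |ψ i j y| ≤ 1 := fun i j y => by
    rw [abs_of_nonneg (hψ0 i j y)]
    exact Set.indicator_le_self' (fun _ _ => zero_le_one) y
  have hzero : ∀ i j, ∫ y, ψ i j y ∂(F i j) = 0 := fun i j => by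
    refine integral_eq_zero_of_ae ?_
    filter_upwards [hQ i j] with y hy
    exact Set.indicator_of_notMem (by simpa using hy) _
  have h1 := h.condExp_transition hP (h.ae_value_pos hP hF) hψm hψ1 r
  simp only [hzero, mul_zero, Finset.sum_const_zero] at h1
  have h2 : ∫ ω, ψ (I r ω) (I (r + 1) ω) (X (r + 1) ω / X r ω) ∂μ = 0 := by
    rw [← integral_condExp (ℱ.le r), integral_congr_ae h1, integral_zero]
  rw [integral_eq_zero_iff_of_nonneg (fun ω => hψ0 _ _ _)
    (h.integrable_transition hψm hψ1 r)] at h2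
  filter_upwards [h2] with ω hω
  by_contra hneg
  have h3 : ψ (I r ω) (I (r + 1) ω) (X (r + 1) ω / X r ω) = 1 := Set.indicator_of_mem hneg _
  exact one_ne_zero (h3.symm.trans hω)

/-- A transition of positive probability out of a recurrent state happens infinitely often. -/
theorem ae_frequently_transition (h : IsMultiplicativeChain P F μ ℱ I X)
    (hP : P ∈ Matrix.rowStochastic ℝ (Fin d)) (hF : BoundedMultipliers F) {i j : Fin d}
    (hij : 0 < P i j) {C : Set ℝ} (hC : MeasurableSet C) (hFC : 0 < (F i j).real C) :
    ∀ᵐ ω ∂μ, (∃ᶠ r in atTop, I r ω = i) →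
      ∃ᶠ r in atTop, I r ω = i ∧ I (r + 1) ω = j ∧ X (r + 1) ω / X r ω ∈ C := by
  classical
  set E : Fin d → Fin d → Set ℝ := fun a b => if a = i ∧ b = j then C else ∅ with hE
  have hEm : ∀ a b, MeasurableSet (E a b) := fun a b => by
    simp only [hE]; split_ifs; exacts [hC, MeasurableSet.empty]
  set ψ : Fin d → Fin d → ℝ → ℝ := fun a b => (E a b).indicator 1 with hψ
  have hψm : ∀ a b, Measurable (ψ a b) := fun a b => measurable_one.indicator (hEm a b)
  have hψ1 : ∀ a b y, |ψ a b y| ≤ 1 := fun a b y => by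
    have h0 : 0 ≤ ψ a b y := Set.indicator_nonneg (fun _ _ => zero_le_one) y
    rw [abs_of_nonneg h0]
    exact Set.indicator_le_self' (fun _ _ => zero_le_one) y
  set p : ℝ := P i j * (F i j).real C with hp
  have hp0 : 0 < p := mul_pos hij hFC
  have hsum : ∀ a, ∑ b, P a b * ∫ y, ψ a b y ∂(F a b) = if a = i then p else 0 := by
    intro a
    have : ∀ b, ∫ y, ψ a b y ∂(F a b) = (F a b).real (E a b) := fun b =>
      integral_indicator_one (hEm a b)
    simp only [this]
    by_cases ha : a = i
    · subst ha
      rw [Finset.sum_eq_single j (fun b _ hb => by simp [hE, hb]) (by simp)]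
      simp [hE, hp]
    · simp [hE, ha]
  -- `S n` concerns the transition into time `n`, hence is known at time `n`. The guard `1 ≤ n`
  -- makes `S 0` empty, where `n - 1` would truncate to `0`.
  set S : ℕ → Set Ω := fun n =>
    {ω | 1 ≤ n ∧ X n ω / X (n - 1) ω ∈ E (I (n - 1) ω) (I n ω)} with hS
  have hSind : ∀ r, (S (r + 1)).indicator (1 : Ω → ℝ) =
      fun ω => ψ (I r ω) (I (r + 1) ω) (X (r + 1) ω / X r ω) := fun r => by
    funext ω
    simp [hS, hψ, Set.indicator_apply]
  have hSm : ∀ n, MeasurableSet[ℱ n] (S n) := by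
    rintro (_ | n)
    · simp [hS]
    · have : S (n + 1) =
          (fun ω => ψ (I n ω) (I (n + 1) ω) (X (n + 1) ω / X n ω)) ⁻¹' {1} := by
        ext ω
        simp [hS, hψ, Set.indicator_apply]
      rw [this]
      exact h.measurable_transition hψm n (measurableSet_singleton 1)
  have hcond : ∀ᵐ ω ∂μ, ∀ r, (μ[(S (r + 1)).indicator (1 : Ω → ℝ) | ℱ r]) ω =
      {ω | I r ω = i}.indicator (fun _ => p) ω := by
    rw [ae_all_iff]
    intro r
    rw [hSind r]
    filter_upwards [h.condExp_transition hP (h.ae_value_pos hP hF) hψm hψ1 r] with ω hω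
    rw [hω, hsum]
    simp [Set.indicator_apply]
  -- Lévy's conditional Borel–Cantelli lemma: each visit to `i` adds `p > 0` to the sum of
  -- conditional probabilities, so infinitely many visits make it diverge.
  filter_upwards [ae_mem_limsup_atTop_iff μ hSm, hcond] with ω hω hc hfreq
  have h1 : ω ∈ limsup (fun r => {ω | I r ω = i}) atTop := mem_limsup_iff_frequently_mem.2 hfreq
  rw [Set.limsup_eq_tendsto_sum_indicator_atTop hp0] at h1
  have h2 : ω ∈ limsup S atTop := by
    refine hω.2 ?_
    simp only [hc]
    exact h1
  rw [← limsup_nat_add S 1, mem_limsup_iff_frequently_mem] at h2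
  refine h2.mono fun r hr => ?_
  have h3 : X (r + 1) ω / X r ω ∈ E (I r ω) (I (r + 1) ω) := by simpa [hS] using hr
  simp only [hE] at h3
  split_ifs at h3 with hcase
  · exact ⟨hcase.1, hcase.2, h3⟩
  · exact absurd h3 (Set.notMem_empty _)

/-- Among finitely many states one is visited infinitely often, and irreducibility carries this
along positive transitions to all. -/
theorem ae_frequently_state (h : IsMultiplicativeChain P F μ ℱ I X)
    (hP : P ∈ Matrix.rowStochastic ℝ (Fin d)) (hirr : P.IsIrreducible)
    (hF : BoundedMultipliers F) : ∀ᵐ ω ∂μ, ∀ i, ∃ᶠ r in atTop, I r ω = i := by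
  have h1 : ∀ᵐ ω ∂μ, ∀ i j, 0 < P i j → (∃ᶠ r in atTop, I r ω = i) →
      ∃ᶠ r in atTop, I r ω = j := by
    simp only [ae_all_iff]
    intro i j hij
    filter_upwards [h.ae_frequently_transition hP hF hij MeasurableSet.univ (by simp)]
      with ω hω hi
    exact ((tendsto_add_atTop_nat 1).frequently ((hω hi).mono fun r hr => hr.2.1))
  filter_upwards [h1] with ω hω
  obtain ⟨k, hk⟩ : ∃ k, ∃ᶠ r in atTop, I r ω = k := by
    by_contra! hno
    have h2 : ∀ᶠ r in atTop, ∀ k, I r ω ≠ k :=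
      eventually_all.2 hno
    obtain ⟨r, hr⟩ := h2.exists
    exact hr _ rfl
  exact forall_of_isIrreducible hirr (p := fun k => ∃ᶠ r in atTop, I r ω = k) hω hk

theorem martingale_sum_transition (h : IsMultiplicativeChain P F μ ℱ I X)
    (hP : P ∈ Matrix.rowStochastic ℝ (Fin d)) (hF : BoundedMultipliers F)
    {ψ : Fin d → Fin d → ℝ → ℝ} (hψ : ∀ i j, Measurable (ψ i j)) {C : ℝ}
    (hC : ∀ i j y, |ψ i j y| ≤ C) (hzero : ∀ i, ∑ j, P i j * ∫ y, ψ i j y ∂(F i j) = 0) :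
    Martingale (fun n ω => ∑ r ∈ Finset.range n,
      ψ (I r ω) (I (r + 1) ω) (X (r + 1) ω / X r ω)) ℱ μ := by
  refine martingale_of_condExp_sub_eq_zero_nat (fun n => ?_) (fun n => ?_) fun n => ?_
  · refine Measurable.stronglyMeasurable (Finset.measurable_sum _ fun r hr => ?_)
    exact (h.measurable_transition hψ r).mono (ℱ.mono (Finset.mem_range.1 hr)) le_rfl
  · exact integrable_finsetSum _ fun r _ => h.integrable_transition hψ hC r
  · have : ((fun ω => ∑ r ∈ Finset.range (n + 1),
        ψ (I r ω) (I (r + 1) ω) (X (r + 1) ω / X r ω)) - fun ω => ∑ r ∈ Finset.range n,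
        ψ (I r ω) (I (r + 1) ω) (X (r + 1) ω / X r ω)) =
        fun ω => ψ (I n ω) (I (n + 1) ω) (X (n + 1) ω / X n ω) := by
      funext ω
      simp [Finset.sum_range_succ]
    rw [this]
    filter_upwards [h.condExp_transition hP (h.ae_value_pos hP hF) hψ hC n] with ω hω
    rw [hω, hzero]
    rfl

theorem ae_hitTime_lt_top (h : IsMultiplicativeChain P F μ ℱ I X)
    (hP : P ∈ Matrix.rowStochastic ℝ (Fin d)) (hirr : P.IsIrreducible)
    (hF : BoundedMultipliers F) {v : Fin d → ℝ} (hv : IsEquilibrium P v)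
    (hm : ∑ i, v i * meanLog P F i = 0) (hdeg : ¬ IsDegenerate P F) {A : ℝ} (hA : 0 < A) :
    ∀ᵐ ω ∂μ, hitTime X A ω < ⊤ := by
  obtain ⟨g, hg⟩ := exists_centering hP hirr hF hv
  obtain ⟨K, hK0, hK⟩ := exists_abs_log_add_le hF g
  obtain ⟨i, j, hij, ε, hε, hjump⟩ := exists_jump_of_not_isDegenerate (g := g) hF hdeg
  set W : Fin d → Fin d → ℝ → ℝ := fun i j y => Real.log y + (g j - g i) with hW
  have hWm : ∀ i j, Measurable (W i j) := fun i j => Real.measurable_log.add_const _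
  -- The increment is truncated at `K` to be bounded everywhere; almost surely this changes nothing
  -- along the path.
  set ψ : Fin d → Fin d → ℝ → ℝ := fun i j y => max (-K) (min K (W i j y)) with hψ
  have hψm : ∀ i j, Measurable (ψ i j) := fun i j =>
    measurable_const.max (measurable_const.min (hWm i j))
  have hψK : ∀ i j y, |ψ i j y| ≤ K := fun i j y =>
    abs_le.2 ⟨le_max_left _ _, max_le (by linarith) (min_le_left _ _)⟩
  have hψW : ∀ i j y, |W i j y| ≤ K → ψ i j y = W i j y := fun i j y hy => by
    simp only [hψ]
    rw [min_eq_right (abs_le.1 hy).2, max_eq_right (abs_le.1 hy).1]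
  have hzero : ∀ i, ∑ j, P i j * ∫ y, ψ i j y ∂(F i j) = 0 := fun i => by
    rw [← hm, ← hg i]
    refine Finset.sum_congr rfl fun j _ => ?_
    congr 1
    exact integral_congr_ae ((hK i j).mono fun y hy => hψW i j y hy.2)
  have hmart := h.martingale_sum_transition hP hF hψm hψK hzero
  have hdiff : ∀ᵐ ω ∂μ, ∀ n, |∑ r ∈ Finset.range (n + 1),
      ψ (I r ω) (I (r + 1) ω) (X (r + 1) ω / X r ω) - ∑ r ∈ Finset.range n,
      ψ (I r ω) (I (r + 1) ω) (X (r + 1) ω / X r ω)| ≤ (⟨K, hK0⟩ : NNReal) :=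
    Eventually.of_forall fun ω n => by
      rw [Finset.sum_range_succ, add_sub_cancel_left]
      exact hψK _ _ _
  have hpath := h.ae_forall_transition hP hF (Q := fun i j => {y | |W i j y| ≤ K})
    (fun i j => measurableSet_le (hWm i j).abs measurable_const)
    (fun i j => (hK i j).mono fun y hy => hy.2)
  -- For bounded increments, bounded below is equivalent to bounded above, and that to convergence,
  -- almost surely.
  filter_upwards [hmart.submartingale.bddAbove_iff_exists_tendsto hdiff,
    hmart.bddAbove_range_iff_bddBelow_range hdiff, hpath, h.ae_value_pos hP hF,
    h.ae_frequently_state hP hirr hF,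
    h.ae_frequently_transition hP hF hij (measurableSet_le measurable_const (hWm i j).abs) hjump]
    with ω hconv hbdd hWK hpos hstate htrans
  set s : ℕ → ℝ := fun n => ∑ r ∈ Finset.range n,
    ψ (I r ω) (I (r + 1) ω) (X (r + 1) ω / X r ω) with hs
  have hstep : ∀ n, s (n + 1) - s n = W (I n ω) (I (n + 1) ω) (X (n + 1) ω / X n ω) := fun n => by
    rw [hs]
    simp only
    rw [Finset.sum_range_succ, add_sub_cancel_left]
    exact hψW _ _ _ (hWK n)
  have hsn : ∀ n, s n = Real.log (X n ω) + g (I n ω) - (Real.log (X 0 ω) + g (I 0 ω)) := by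
    intro n
    induction n with
    | zero => simp [hs]
    | succ n ih =>
      have h1 := hstep n
      simp only [hW] at h1
      rw [Real.log_div (hpos _).ne' (hpos _).ne'] at h1
      linarith
  have hnot : ¬ ∃ c, Tendsto s atTop (𝓝 c) := by
    rintro ⟨c, hc⟩
    have h1 : Tendsto (fun n => |s (n + 1) - s n|) atTop (𝓝 0) := by
      simpa using ((hc.comp (tendsto_add_atTop_nat 1)).sub hc).abs
    obtain ⟨n, ⟨hn1, hn2, hn3⟩, hn4⟩ :=
      ((htrans (hstate i)).and_eventually (h1.eventually_lt_const hε)).exists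
    rw [hstep n, hn1, hn2] at hn4
    exact absurd hn3 (not_le.2 hn4)
  have hunb : ¬ BddBelow (Set.range s) := fun hb => hnot (hconv.1 (hbdd.2 hb))
  -- Below `0` the time `n` cannot be `0`, since `s 0 = 0`. Below the second term, `log X_n ≤ log A`
  -- whatever the state, as `|g|` is at most `∑ k, |g k|`.
  set c := min 0 (Real.log A - ∑ k, |g k| - (Real.log (X 0 ω) + g (I 0 ω)))
  obtain ⟨n, hn⟩ : ∃ n, s n < c := by
    by_contra! hall
    exact hunb ⟨c, by rintro _ ⟨n, rfl⟩; exact hall n⟩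
  have hn0 : 0 < n := by
    refine Nat.pos_of_ne_zero fun h0 => ?_
    have h1 : s n = 0 := by rw [h0]; simp [hs]
    exact absurd (hn.trans_le (min_le_left _ _)) (by rw [h1]; exact lt_irrefl _)
  have hXA : X n ω ≤ A := by
    have h1 := hn.trans_le (min_le_right _ _)
    have h2 : -g (I n ω) ≤ ∑ k, |g k| := (neg_le_abs _).trans
      (Finset.single_le_sum (f := fun k => |g k|) (fun _ _ => abs_nonneg _) (Finset.mem_univ _))
    rw [hsn n] at h1
    exact (Real.log_le_log_iff (hpos n) hA).1 (by linarith)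
  exact (iInf₂_le n ⟨hn0, hXA⟩).trans_lt (ENat.natCast_lt_top n)

end IsMultiplicativeChain

end MultiplicativeModel

theorem theorem3p1 {d : ℕ} {Ω : Type*} [mΩ : MeasurableSpace Ω]
    (P : Matrix (Fin d) (Fin d) ℝ) (hP : P ∈ Matrix.rowStochastic ℝ (Fin d))
    (hirr : P.IsIrreducible)
    (F : Fin d → Fin d → Measure ℝ) (hFprob : ∀ i j, IsProbabilityMeasure (F i j))
    (hF : MultiplicativeModel.BoundedMultipliers F)
    (v : Fin d → ℝ) (hv : MultiplicativeModel.IsEquilibrium P v)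
    (μ : Measure Ω) [IsProbabilityMeasure μ] (ℱ : Filtration ℕ mΩ)
    (I : ℕ → Ω → Fin d) (X : ℕ → Ω → ℝ)
    (hIX : MultiplicativeModel.IsMultiplicativeChain P F μ ℱ I X) :
    (∀ s : ℝ, 0 < s → ∃! η : ℝ, MultiplicativeModel.IsPerronFrobeniusEigenvalue
        (MultiplicativeModel.momentMatrix P F s) η) ∧
    (∑ i, v i * MultiplicativeModel.meanLog P F i < 0 →
      (∀ᵐ ω ∂μ, Tendsto (fun r => X r ω) atTop (𝓝 0)) ∧
      (∀ᵐ ω ∂μ, MultiplicativeModel.totalTime X ω < ⊤) ∧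
      ∀ s : ℝ, 0 < s → ∀ η : ℝ, MultiplicativeModel.IsPerronFrobeniusEigenvalue
          (MultiplicativeModel.momentMatrix P F s) η →
        (η < 1 → ∫⁻ ω, ENNReal.ofReal (X 0 ω) ^ s ∂μ < ⊤ →
          ∫⁻ ω, MultiplicativeModel.totalTime X ω ^ s ∂μ < ⊤) ∧
        (1 ≤ η → ∫⁻ ω, MultiplicativeModel.totalTime X ω ^ s ∂μ = ⊤)) ∧
    (∑ i, v i * MultiplicativeModel.meanLog P F i = 0 →
      ¬ MultiplicativeModel.IsDegenerate P F →
      ∀ A : ℝ, 0 < A → ∀ᵐ ω ∂μ, MultiplicativeModel.hitTime X A ω < ⊤) ∧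
    (0 < ∑ i, v i * MultiplicativeModel.meanLog P F i →
      ∀ᵐ ω ∂μ, Tendsto (fun r => X r ω) atTop atTop) := by

  have hd : Nonempty (Fin d) := by
    by_contra hne
    rw [not_nonempty_iff] at hne
    simpa using hv.1.2
  have hvec : ∀ s : ℝ, ∃ η : ℝ, 0 < η ∧ ∃ w : Fin d → ℝ, (∀ i, 0 < w i) ∧
      (MultiplicativeModel.momentMatrix P F s).mulVec w = η • w := fun s =>
    MultiplicativeModel.exists_pos_eigenvector hd
      (MultiplicativeModel.isIrreducible_momentMatrix hirr hF s)
  have hPF : ∀ (s η : ℝ) (w : Fin d → ℝ), 0 < η → (∀ i, 0 < w i) →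
      (MultiplicativeModel.momentMatrix P F s).mulVec w = η • w →
      MultiplicativeModel.IsPerronFrobeniusEigenvalue
        (MultiplicativeModel.momentMatrix P F s) η := fun s η w h0 hw h =>
    MultiplicativeModel.isPerronFrobeniusEigenvalue_of_pos_eigenvector hd
      (MultiplicativeModel.isIrreducible_momentMatrix hirr hF s).nonneg h0 hw h
  refine ⟨fun s _ => ?_, fun hm => ?_, fun hm hdeg A hA =>
    hIX.ae_hitTime_lt_top hP hirr hF hv hm hdeg hA, fun hm =>
    hIX.ae_tendsto_atTop hP hirr hF hv hm⟩
  · obtain ⟨η, h0, w, hw, h⟩ := hvec s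
    exact ⟨η, hPF s η w h0 hw h, fun η' h' => h'.unique (hPF s η w h0 hw h)⟩
  · have hlim := hIX.ae_tendsto_zero_and_totalTime_lt_top hP hirr hF hv hm
    refine ⟨hlim.mono fun ω h => h.1, hlim.mono fun ω h => h.2, fun s hs η' h' => ?_⟩
    obtain ⟨η, h0, w, hw, h⟩ := hvec s
    -- Uniqueness identifies the given eigenvalue with the one that has a positive eigenvector.
    rw [h'.unique (hPF s η w h0 hw h)]
    exact ⟨fun hη h0 => hIX.lintegral_totalTime_rpow_lt_top hP hF hs hη hw h h0, fun hη =>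
      hIX.lintegral_totalTime_rpow_eq_top hP hF hs hη hw h (hlim.mono fun ω h => h.1)⟩
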